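/- Let $V$ be a complex vector space of finite dimension $n$. Write $\Lambda^{p,q}V^*$ for the space of $(p,q)$-forms on $V$; call a $(k,0)$-form decomposable if it is a wedge product of $k$ forms of type $(1,0)$ (for $k=0$: the constant $1$), and call an $(n,n)$-form positive if it is a non-negative multiple of $i\alpha^1\wedge\bar\alpha^1\wedge\dots\wedge i\alpha^n\wedge\bar\alpha^n$ for a basis $\alpha^1,\dots,\alpha^n$ of $\Lambda^{1,0}V^*$. A real $(p,p)$-form $\Omega$ on $V$ is weakly positive (resp. Hermitian positive) if $i^{(n-p)^2}\,\Omega\wedge\psi\wedge\bar\psi$ is positive for all decomposable $\psi\in\Lambda^{n-p,0}V^*$ (resp. for all $\psi\in\Lambda^{n-p,0}V^*$; if $p>n$ there is no condition), and strongly positive if $\Omega=i^{p^2}\sum_j c_j\,\psi_j\wedge\bar\psi_j$ is a finite sum with $c_j\ge 0$ and decomposable $\psi_j\in\Lambda^{p,0}V^*$. Let $\mathcal C^p=\mathcal C^p(V)$ denote any one of the three cones so obtained, $\mathring{\mathcal C}^p$ its interior in the real vector space of real $(p,p)$-forms on $V$, and, for a hyperplane $\mathfrak h\subset V$, let $\mathcal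 C^p_{\mathfrak h}$, $\mathring{\mathcal C}^p_{\mathfrak h}$ be the cone of the same type on the vector space $\mathfrak h$ and its interior. Fix a (linear) hyperplane $\mathfrak h\subset V$, a vector $v_0\in V\setminus\mathfrak h$, a $(1,0)$-form $\alpha$ on $V$ with $\alpha(v_0)\neq 0$ (for instance $\alpha(v_0)=1$), and $1\le p\le n$. Let $\rho$ be the extension of forms on $\mathfrak h$ to forms on $V$ by pull-back along the projection $V=\mathfrak h\oplus\mathbb C v_0\to\mathfrak h$. Then: (1) Every real $(p,p)$-form $\Omega$ on $V$ can be written in exactly one way as $$\Omega=\Xi+\alpha\wedge\eta+\bar\alpha\wedge\bar\eta+i\,\alpha\wedge\bar\alpha\wedge\vartheta,\qquad \Xi\in\rho(\Lambda^{p,p}\mathfrak h^*),\ \eta\in\rho(\Lambda^{p-1,p}\mathfrak h^*),\ \vartheta\in\rho(\Lambda^{p-1,p-1}\mathfrak h^*),$$ and $\Xi$, $\vartheta$ are real. (2) If $\Omega\in\mathcal C^p$, then $\Omega|_{\mathfrak h}\in\mathcal C^p_{\mathfrak h}$, $\Xi|_{\mathfrak h}\in\mathcal C^p_{\mathfrak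 h}$ and $\vartheta|_{\mathfrak h}\in\mathcal C^{p-1}_{\mathfrak h}$. If $\Omega\in\mathring{\mathcal C}^p$, then $\Omega|_{\mathfrak h}\in\mathring{\mathcal C}^p_{\mathfrak h}$, $\Xi|_{\mathfrak h}\in\mathring{\mathcal C}^p_{\mathfrak h}$ and $\vartheta|_{\mathfrak h}\in\mathring{\mathcal C}^{p-1}_{\mathfrak h}$. (3) Conversely, let $\Xi\in\rho(\Lambda^{p,p}\mathfrak h^*)$, $\vartheta\in\rho(\Lambda^{p-1,p-1}\mathfrak h^*)$ and $\Omega=\Xi+i\,\alpha\wedge\bar\alpha\wedge\vartheta$ (the case $\eta=0$). If $\Xi|_{\mathfrak h}\in\mathcal C^p_{\mathfrak h}$ and $\vartheta|_{\mathfrak h}\in\mathcal C^{p-1}_{\mathfrak h}$, then $\Omega\in\mathcal C^p$; if $\Xi|_{\mathfrak h}\in\mathring{\mathcal C}^p_{\mathfrak h}$ and $\vartheta|_{\mathfrak h}\in\mathring{\mathcal C}^{p-1}_{\mathfrak h}$, then $\Omega\in\mathring{\mathcal C}^p$. -/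

import Mathlib

open Module

noncomputable section

namespace PositiveForms

/-- Complex-valued exterior forms on a complex vector space `V`: the exterior algebra over `ℂ` of
the space `Hom_ℝ(V, ℂ) = V^* ⊗ ℂ` of complex-valued covectors. The wedge product is the
multiplication of this algebra. -/
abbrev Form (V : Type*) [AddCommGroup V] [Module ℂ V] : Type _ :=
  ExteriorAlgebra ℂ (V →ₗ[ℝ] ℂ)

/-- Forms as a real vector space, by restriction of scalars (a shortcut for instance search). -/
instance (V : Type*) [AddCommGroup V] [Module ℂ V] : Module ℝ (Form V) :=
  Module.complexToReal (Form V)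

section Conj

variable (V : Type*) [AddCommGroup V] [Module ℂ V]

/-- The ring of forms, with `c : ℂ` acting as multiplication by the conjugate of `c`. -/
def ConjForm : Type _ := Form V

instance : Ring (ConjForm V) := inferInstanceAs (Ring (Form V))

instance : Algebra ℂ (ConjForm V) := Algebra.compHom (Form V) (starRingEnd ℂ)

variable {V}

/-- The complex conjugate of a complex-valued covector. -/
def conjCovector (f : V →ₗ[ℝ] ℂ) : V →ₗ[ℝ] ℂ :=
  Complex.conjAe.toLinearMap ∘ₗ f

variable (V) in
/-- Conjugation of covectors, as a `ℂ`-linear map into the conjugate of the algebra of forms. -/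
def conjι : (V →ₗ[ℝ] ℂ) →ₗ[ℂ] ConjForm V where
  toFun f := (ExteriorAlgebra.ι ℂ (conjCovector f) : Form V)
  map_add' f g := by
    have h : conjCovector (f + g) = conjCovector f + conjCovector g := by
      ext x; simp [conjCovector]
    rw [h]; exact map_add (ExteriorAlgebra.ι ℂ) _ _
  map_smul' c f := by
    have h : conjCovector (c • f) = (starRingEnd ℂ c) • conjCovector f := by
      ext x; simp [conjCovector]
    rw [h]; exact map_smul (ExteriorAlgebra.ι ℂ) _ _

variable (V) in
/-- Complex conjugation of forms: the conjugate-linear ring homomorphism which conjugates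
covectors. -/
def conj : Form V →+* Form V :=
  (ExteriorAlgebra.lift ℂ ⟨conjι V, fun f =>
    ExteriorAlgebra.ι_sq_zero (R := ℂ) (conjCovector f)⟩ : Form V →ₐ[ℂ] ConjForm V).toRingHom

theorem conj_ι (f : V →ₗ[ℝ] ℂ) :
    conj V (ExteriorAlgebra.ι ℂ f) = ExteriorAlgebra.ι ℂ (conjCovector f) :=
  ExteriorAlgebra.lift_ι_apply ℂ (A := ConjForm V) (conjι V) _ f

theorem conj_smul (c : ℂ) (ω : Form V) : conj V (c • ω) = (starRingEnd ℂ c) • conj V ω :=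
  map_smul (ExteriorAlgebra.lift ℂ ⟨conjι V, fun f =>
    ExteriorAlgebra.ι_sq_zero (R := ℂ) (conjCovector f)⟩ : Form V →ₐ[ℂ] ConjForm V) c ω

end Conj

section Forms

variable {V : Type*} [AddCommGroup V] [Module ℂ V]

/-- The `(1,0)`-form given by a `ℂ`-linear functional. -/
def oneForm (a : Dual ℂ V) : Form V := ExteriorAlgebra.ι ℂ (a.restrictScalars ℝ)

/-- The decomposable `(k,0)`-form `μ₁ ∧ ⋯ ∧ μₖ` (equal to `1` if `k = 0`). -/
def wedge {k : ℕ} (μ : Fin k → Dual ℂ V) : Form V := (List.ofFn fun j => oneForm (μ j)).prod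

variable (V) in
/-- The space `Λ^{p,q} V^*` of `(p,q)`-forms. -/
def pqForms (p q : ℕ) : Submodule ℂ (Form V) :=
  Submodule.span ℂ {ω | ∃ (μ : Fin p → Dual ℂ V) (ν : Fin q → Dual ℂ V),
    ω = wedge μ * conj V (wedge ν)}

variable (V) in
/-- The real vector space of real `(p,p)`-forms, those equal to their complex conjugate. -/
def realForms (p : ℕ) : Submodule ℝ (Form V) where
  carrier := {Ω | Ω ∈ pqForms V p p ∧ conj V Ω = Ω}
  zero_mem' := ⟨zero_mem _, map_zero _⟩
  add_mem' := fun {a b} ha hb => ⟨add_mem ha.1 hb.1, by rw [map_add, ha.2, hb.2]⟩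
  smul_mem' := fun c a ha => by
    change (c : ℂ) • a ∈ pqForms V p p ∧ conj V ((c : ℂ) • a) = (c : ℂ) • a
    exact ⟨Submodule.smul_mem _ _ ha.1, by rw [conj_smul, Complex.conj_ofReal, ha.2]⟩

instance (p : ℕ) : Module ℝ (realForms V p) := Submodule.module (realForms V p)

/-- The volume form `i α¹ ∧ ᾱ¹ ∧ ⋯ ∧ i αⁿ ∧ ᾱⁿ` of a basis of `(1,0)`-forms. -/
def volForm (b : Basis (Fin (finrank ℂ V)) ℂ (Dual ℂ V)) : Form V :=
  (List.ofFn fun j => Complex.I • (oneForm (b j) * conj V (oneForm (b j)))).prod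

/-- Positivity of an `(n,n)`-form, `n = dim V`: it is a non-negative multiple of the volume form
of a basis of `(1,0)`-forms. (Such volume forms are positive multiples of each other.) -/
def IsPositiveTop (ν : Form V) : Prop :=
  ∃ (b : Basis (Fin (finrank ℂ V)) ℂ (Dual ℂ V)) (c : ℝ), 0 ≤ c ∧ ν = (c : ℂ) • volForm b

/-- The three positivity types. -/
inductive PosType
  | weak
  | hermitian
  | strong

variable (V) in
/-- The cone of weakly, Hermitian or strongly positive real `(p,p)`-forms on `V`. The complementary
degree `q` is the natural number with `p + q = dim V`. -/
def posCone : PosType → ℕ → Set (Form V)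
  | .weak, p => {Ω | Ω ∈ realForms V p ∧
      ∀ q : ℕ, p + q = finrank ℂ V → ∀ μ : Fin q → Dual ℂ V,
        IsPositiveTop (Complex.I ^ (q ^ 2) • (Ω * wedge μ * conj V (wedge μ)))}
  | .hermitian, p => {Ω | Ω ∈ realForms V p ∧
      ∀ q : ℕ, p + q = finrank ℂ V → ∀ ψ ∈ pqForms V q 0,
        IsPositiveTop (Complex.I ^ (q ^ 2) • (Ω * ψ * conj V ψ))}
  | .strong, p => {Ω | ∃ (m : ℕ) (c : Fin m → ℝ) (μ : Fin m → Fin p → Dual ℂ V),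
      (∀ j, 0 ≤ c j) ∧
        Ω = Complex.I ^ (p ^ 2) • ∑ j, (c j : ℂ) • (wedge (μ j) * conj V (wedge (μ j)))}

variable (V) in
/-- The interior of the cone `posCone V t p` in the real vector space of real `(p,p)`-forms, which
carries its canonical topology. -/
def intCone (t : PosType) (p : ℕ) : Set (Form V) :=
  letI : TopologicalSpace (realForms V p) := moduleTopology ℝ (realForms V p)
  (Subtype.val : realForms V p → Form V) ''
    interior ((Subtype.val : realForms V p → Form V) ⁻¹' posCone V t p)

end Forms

section Hyperplane

/-- Pull-back of covectors along a linear map. -/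
def pullbackCovector {V W : Type*} [AddCommGroup V] [Module ℂ V] [AddCommGroup W] [Module ℂ W]
    (f : W →ₗ[ℂ] V) : (V →ₗ[ℝ] ℂ) →ₗ[ℂ] (W →ₗ[ℝ] ℂ) where
  toFun φ := φ ∘ₗ f.restrictScalars ℝ
  map_add' _ _ := rfl
  map_smul' _ _ := rfl

/-- Pull-back of forms along a linear map. -/
def pullback {V W : Type*} [AddCommGroup V] [Module ℂ V] [AddCommGroup W] [Module ℂ W]
    (f : W →ₗ[ℂ] V) : Form V →ₐ[ℂ] Form W :=
  ExteriorAlgebra.map (pullbackCovector f)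

variable {V : Type*} [AddCommGroup V] [Module ℂ V]

/-- Restriction of forms to a subspace. -/
def restrict (H : Submodule ℂ V) : Form V →ₐ[ℂ] Form H := pullback H.subtype

/-- The projection `V → H` along the line spanned by `v₀`, where `H` is a hyperplane and
`v₀ ∉ H`. -/
def projAlong (H : Submodule ℂ V) (v₀ : V) (hH : IsCoatom H) (hv₀ : v₀ ∉ H) : V →ₗ[ℂ] H :=
  H.projectionOnto (ℂ ∙ v₀) (Submodule.isCompl_span_singleton_of_isCoatom_of_notMem hH hv₀)

/-- The extension of forms on the hyperplane `H` to forms on `V` that vanish in the direction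
of `v₀`. -/
def rho (H : Submodule ℂ V) (v₀ : V) (hH : IsCoatom H) (hv₀ : v₀ ∉ H) : Form H →ₐ[ℂ] Form V :=
  pullback (projAlong H v₀ hH hv₀)

/-- `Ω = Ξ + α ∧ η + ᾱ ∧ η̄ + i α ∧ ᾱ ∧ ϑ`, where `Ξ`, `η`, `ϑ` are the extensions of forms on `H` of
bidegree `(p,p)`, `(p-1,p)`, `(p-1,p-1)`. -/
def IsSplitting (H : Submodule ℂ V) (v₀ : V) (hH : IsCoatom H) (hv₀ : v₀ ∉ H) (α : Dual ℂ V)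
    (p : ℕ) (Ω Ξ η ϑ : Form V) : Prop :=
  Ξ ∈ (pqForms H p p).map (rho H v₀ hH hv₀).toLinearMap ∧
  η ∈ (pqForms H (p - 1) p).map (rho H v₀ hH hv₀).toLinearMap ∧
  ϑ ∈ (pqForms H (p - 1) (p - 1)).map (rho H v₀ hH hv₀).toLinearMap ∧
  Ω = Ξ + oneForm α * η + conj V (oneForm α) * conj V η +
    Complex.I • (oneForm α * conj V (oneForm α) * ϑ)

end Hyperplane

end PositiveForms

end

/-! Everything is reduced to a splitting `V = W ⊕ ℂe` with coordinate covector `γ`, packaged as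
`LineSplitting`. A `(p,p)`-form is then `ξ + γ∧η + γ̄∧ζ + iγ∧γ̄∧θ` with components from `W`;
restriction to `W` recovers `ξ`, and contraction with the two types of `e` recovers `η` and `θ`,
which gives uniqueness. Reality forces `ζ = η̄`.

Two splittings share the projection along `v₀`. The one with `W` embedded as `ker α` has `γ = α` and
is the decomposition of the theorem: `Ξ|_H` is the restriction of `Ω` to `ker α`, transported to
`H`, and `ϑ|_H` is its fibre component. The one with `W` embedded as `H` yields `Ω|_H`. So
positivity of all three forms follows from `res_mem_posCone` and `fiber_mem_posCone`.

The algebraic heart is `exists_wedge_eq`: a decomposable form on `V` is `(β + cγ)∧χ` with `β`, `χ`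
from `W`, hence `A + γ∧B` with `A = β∧χ` and `B = cχ` both decomposable. Strong positivity is
checked on such generators. Weak and Hermitian positivity are checked by testing: `γ∧χ` on `V` tests
`ξ` against `χ`, the form `χ` tests `θ`, and for `η = 0` the test against `A + γ∧B` reduces, for
degree reasons, to `ξ∧|B|² + θ∧|A|²` (`comb_mem_posCone`), where `|ψ|²` is `absSq`.

Interiors are handled algebraically (`mem_intCone_iff`): a point is interior when a small multiple
of every real form can be subtracted. By polarization only generators of the strong cone need be
subtracted (`mem_intCone_of_generators`). In `comb_mem_intCone` the mixed terms of the generator `|A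
+ γ∧B|²` are cancelled by adding its reflection `|A − γ∧B|²`, which is positive. -/

namespace PositiveForms

/-! ### Graded commutativity, bidegrees and vanishing above the dimension. -/

section Wedge

variable {V : Type*} [AddCommGroup V] [Module ℂ V]

theorem wedge_of_zero (μ : Fin 0 → Dual ℂ V) : wedge μ = 1 := by simp [wedge]

theorem wedge_succ {k : ℕ} (μ : Fin (k + 1) → Dual ℂ V) :
    wedge μ = oneForm (μ 0) * wedge (fun j => μ j.succ) := by
  simp [wedge, List.ofFn_succ]

theorem wedge_cons {k : ℕ} (a : Dual ℂ V) (μ : Fin k → Dual ℂ V) :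
    wedge (Fin.cons a μ : Fin (k + 1) → Dual ℂ V) = oneForm a * wedge μ := by
  rw [wedge_succ]; simp

theorem wedge_append {k l : ℕ} (μ : Fin k → Dual ℂ V) (ν : Fin l → Dual ℂ V) :
    wedge (Fin.append μ ν) = wedge μ * wedge ν := by
  rw [wedge, wedge, wedge, ← List.prod_append, ← List.ofFn_fin_append]
  congr 2
  funext j
  refine Fin.addCases (fun i => ?_) (fun i => ?_) j <;> simp

theorem oneForm_add (a b : Dual ℂ V) : oneForm (a + b) = oneForm a + oneForm b :=
  map_add (ExteriorAlgebra.ι ℂ) (a.restrictScalars ℝ) (b.restrictScalars ℝ)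

theorem oneForm_smul (c : ℂ) (a : Dual ℂ V) : oneForm (c • a) = c • oneForm a :=
  map_smul (ExteriorAlgebra.ι ℂ) c (a.restrictScalars ℝ)

theorem oneForm_sq (a : Dual ℂ V) : oneForm a * oneForm a = 0 :=
  ExteriorAlgebra.ι_sq_zero _

theorem conj_algebraMap (c : ℂ) :
    conj V (algebraMap ℂ (Form V) c) = algebraMap ℂ (Form V) (starRingEnd ℂ c) := by
  rw [Algebra.algebraMap_eq_smul_one, Algebra.algebraMap_eq_smul_one, conj_smul, map_one]

theorem conjCovector_conjCovector (f : V →ₗ[ℝ] ℂ) : conjCovector (conjCovector f) = f := by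
  ext x; simp [conjCovector]

theorem conj_conj (ω : Form V) : conj V (conj V ω) = ω := by
  induction ω using ExteriorAlgebra.induction with
  | algebraMap r => simp [conj_algebraMap]
  | ι x => rw [conj_ι, conj_ι, conjCovector_conjCovector]
  | mul a b ha hb => rw [map_mul, map_mul, ha, hb]
  | add a b ha hb => rw [map_add, map_add, ha, hb]

/-- Forms of total degree `k`. -/
noncomputable abbrev degForms (V : Type*) [AddCommGroup V] [Module ℂ V] (k : ℕ) :
    Submodule ℂ (Form V) :=
  LinearMap.range (ExteriorAlgebra.ι ℂ (M := V →ₗ[ℝ] ℂ)) ^ k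

theorem ι_mul_of_mem_degForms {k : ℕ} {ω : Form V} (hω : ω ∈ degForms V k) (x : V →ₗ[ℝ] ℂ) :
    ExteriorAlgebra.ι ℂ x * ω = (-1 : ℂ) ^ k • (ω * ExteriorAlgebra.ι ℂ x) := by
  induction hω using Submodule.pow_induction_on_left' with
  | algebraMap r => simp [Algebra.commutes]
  | add a b i _ _ ha hb => rw [mul_add, ha, hb, add_mul, smul_add]
  | mem_mul m hm i a ha ih =>
    obtain ⟨y, rfl⟩ := hm
    have h := ExteriorAlgebra.ι_add_mul_swap (R := ℂ) x y
    rw [← mul_assoc, eq_neg_of_add_eq_zero_left h, neg_mul, mul_assoc, ih, mul_smul_comm,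
      pow_succ, mul_neg_one, neg_smul, mul_assoc]

theorem mul_comm_of_mem_degForms {k l : ℕ} {ω τ : Form V} (hω : ω ∈ degForms V k)
    (hτ : τ ∈ degForms V l) : ω * τ = (-1 : ℂ) ^ (k * l) • (τ * ω) := by
  induction hω using Submodule.pow_induction_on_left' with
  | algebraMap r => simp [Algebra.commutes]
  | add a b i _ _ ha hb => rw [mul_add, add_mul, ha, hb, smul_add]
  | mem_mul m hm i a ha ih =>
    obtain ⟨y, rfl⟩ := hm
    rw [mul_assoc, ih, mul_smul_comm, ← mul_assoc, ι_mul_of_mem_degForms hτ, smul_mul_assoc,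
      smul_smul, mul_assoc]
    congr 1; rw [← pow_add]; congr 1; rw [Nat.succ_eq_add_one]; ring

theorem commute_of_mem_degForms {k : ℕ} {ω : Form V} (hω : ω ∈ degForms V (2 * k))
    (τ : Form V) : Commute ω τ := by
  induction τ using ExteriorAlgebra.induction with
  | algebraMap r => exact (Algebra.commutes r ω).symm
  | ι x =>
    have h := ι_mul_of_mem_degForms hω x
    rw [pow_mul, neg_one_sq, one_pow, one_smul] at h
    exact h.symm
  | mul a b ha hb => exact ha.mul_right hb
  | add a b ha hb => exact ha.add_right hb

theorem ι_mem_degForms (x : V →ₗ[ℝ] ℂ) : ExteriorAlgebra.ι ℂ x ∈ degForms V 1 := by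
  rw [degForms, pow_one]; exact ⟨x, rfl⟩

theorem wedge_mem_degForms {k : ℕ} (μ : Fin k → Dual ℂ V) : wedge μ ∈ degForms V k := by
  induction k with
  | zero => rw [wedge_of_zero, degForms, pow_zero]; exact Submodule.one_le.mp le_rfl
  | succ k ih =>
    rw [wedge_succ, degForms, pow_succ']
    exact Submodule.mul_mem_mul ⟨_, rfl⟩ (ih _)

theorem conj_mem_degForms {k : ℕ} {ω : Form V} (hω : ω ∈ degForms V k) :
    conj V ω ∈ degForms V k := by
  induction hω using Submodule.pow_induction_on_left' with
  | algebraMap r =>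
    rw [conj_algebraMap, degForms, pow_zero, Algebra.algebraMap_eq_smul_one]
    exact Submodule.smul_mem _ _ (Submodule.one_le.mp le_rfl)
  | add a b i _ _ ha hb => rw [map_add]; exact add_mem ha hb
  | mem_mul m hm i a ha ih =>
    obtain ⟨y, rfl⟩ := hm
    rw [map_mul, conj_ι, degForms, pow_succ']
    exact Submodule.mul_mem_mul ⟨_, rfl⟩ ih

theorem pqForms_le_degForms (p q : ℕ) : pqForms V p q ≤ degForms V (p + q) := by
  refine Submodule.span_le.mpr ?_
  rintro _ ⟨μ, ν, rfl⟩
  rw [SetLike.mem_coe, degForms, pow_add]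
  exact Submodule.mul_mem_mul (wedge_mem_degForms μ) (conj_mem_degForms (wedge_mem_degForms ν))

theorem mul_comm_of_mem_pqForms {a b c d : ℕ} {ω τ : Form V} (hω : ω ∈ pqForms V a b)
    (hτ : τ ∈ pqForms V c d) : ω * τ = (-1 : ℂ) ^ ((a + b) * (c + d)) • (τ * ω) :=
  mul_comm_of_mem_degForms (pqForms_le_degForms _ _ hω) (pqForms_le_degForms _ _ hτ)

theorem commute_of_mem_pqForms {p : ℕ} {ω : Form V} (hω : ω ∈ pqForms V p p)
    (τ : Form V) : Commute ω τ :=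
  commute_of_mem_degForms (k := p) (by rw [two_mul]; exact pqForms_le_degForms _ _ hω) τ

theorem wedge_mem_pqForms {k : ℕ} (μ : Fin k → Dual ℂ V) : wedge μ ∈ pqForms V k 0 :=
  Submodule.subset_span ⟨μ, Fin.elim0, by simp [wedge_of_zero]⟩

theorem oneForm_mem_pqForms (a : Dual ℂ V) : oneForm a ∈ pqForms V 1 0 := by
  have h := wedge_mem_pqForms (fun _ : Fin 1 => a)
  rwa [wedge_succ, wedge_of_zero, mul_one] at h

theorem conj_mem_pqForms {p q : ℕ} {ω : Form V} (hω : ω ∈ pqForms V p q) :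
    conj V ω ∈ pqForms V q p := by
  induction hω using Submodule.span_induction with
  | mem x hx =>
    obtain ⟨μ, ν, rfl⟩ := hx
    rw [map_mul, conj_conj, mul_comm_of_mem_degForms (conj_mem_degForms (wedge_mem_degForms μ))
      (wedge_mem_degForms ν)]
    exact Submodule.smul_mem _ _ (Submodule.subset_span ⟨ν, μ, rfl⟩)
  | zero => rw [map_zero]; exact zero_mem _
  | add x y _ _ hx hy => rw [map_add]; exact add_mem hx hy
  | smul c x _ hx => rw [conj_smul]; exact Submodule.smul_mem _ _ hx

theorem mul_mem_pqForms {a b c d : ℕ} {ω τ : Form V} (hω : ω ∈ pqForms V a b)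
    (hτ : τ ∈ pqForms V c d) : ω * τ ∈ pqForms V (a + c) (b + d) := by
  have h : pqForms V a b * pqForms V c d ≤ pqForms V (a + c) (b + d) := by
    rw [pqForms, pqForms, Submodule.span_mul_span, Submodule.span_le]
    rintro _ ⟨_, ⟨μ, ν, rfl⟩, _, ⟨μ', ν', rfl⟩, rfl⟩
    have h1 : wedge μ * conj V (wedge ν) * (wedge μ' * conj V (wedge ν')) =
        (-1 : ℂ) ^ (b * c) •
          (wedge (Fin.append μ μ') * conj V (wedge (Fin.append ν ν'))) := by
      rw [wedge_append, wedge_append, map_mul, mul_assoc, ← mul_assoc (conj V (wedge ν)),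
        mul_comm_of_mem_degForms (conj_mem_degForms (wedge_mem_degForms ν))
          (wedge_mem_degForms μ'), smul_mul_assoc, mul_smul_comm]
      simp only [mul_assoc]
    simp only [SetLike.mem_coe]
    rw [h1]
    exact Submodule.smul_mem _ _ (Submodule.subset_span ⟨_, _, rfl⟩)
  exact h (Submodule.mul_mem_mul hω hτ)

theorem mem_pqForms_of_eq {a b c d : ℕ} {ω : Form V} (hω : ω ∈ pqForms V a b) (hac : a = c)
    (hbd : b = d) : ω ∈ pqForms V c d := by
  subst hac hbd; exact hω

theorem mul_mem_pqForms_zero {a b : ℕ} {ω τ : Form V} (hω : ω ∈ pqForms V a 0)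
    (hτ : τ ∈ pqForms V b 0) : ω * τ ∈ pqForms V (a + b) 0 :=
  mem_pqForms_of_eq (mul_mem_pqForms hω hτ) rfl (add_zero 0)

/-- The `ℂ`-multilinear alternating map `μ ↦ μ₁ ∧ ⋯ ∧ μₖ`. -/
noncomputable def wedgeMap (V : Type*) [AddCommGroup V] [Module ℂ V] (k : ℕ) :
    Dual ℂ V [⋀^Fin k]→ₗ[ℂ] Form V :=
  (ExteriorAlgebra.ιMulti ℂ k).compLinearMap (LinearMap.restrictScalarsₗ ℝ ℂ V ℂ ℂ)

theorem wedgeMap_apply {k : ℕ} (μ : Fin k → Dual ℂ V) : wedgeMap V k μ = wedge μ := by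
  rw [wedgeMap, AlternatingMap.compLinearMap_apply, ExteriorAlgebra.ιMulti_apply]; rfl

theorem wedge_eq_zero_of_finrank_lt [FiniteDimensional ℂ V] {k : ℕ} (hk : finrank ℂ V < k)
    (μ : Fin k → Dual ℂ V) : wedge μ = 0 := by
  rw [← wedgeMap_apply]
  refine AlternatingMap.map_linearDependent _ _ fun h => ?_
  have := h.fintype_card_le_finrank
  rw [Fintype.card_fin, Subspace.dual_finrank_eq] at this
  omega

theorem eq_zero_of_mem_pqForms [FiniteDimensional ℂ V] {a b : ℕ} {ω : Form V}
    (hω : ω ∈ pqForms V a b) (h : finrank ℂ V < a ∨ finrank ℂ V < b) : ω = 0 := by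
  induction hω using Submodule.span_induction with
  | mem x hx =>
    obtain ⟨μ, ν, rfl⟩ := hx
    rcases h with h | h
    · rw [wedge_eq_zero_of_finrank_lt h, zero_mul]
    · rw [wedge_eq_zero_of_finrank_lt h ν, map_zero, mul_zero]
  | zero => rfl
  | add x y _ _ hx hy => rw [hx, hy, add_zero]
  | smul c x _ hx => rw [hx, smul_zero]

/-- Both sides are alternating in `μ`, so it suffices to compare them on permutations of the basis.
-/
theorem wedge_eq_det_smul {k : ℕ} (b : Basis (Fin k) ℂ (Dual ℂ V)) (μ : Fin k → Dual ℂ V) :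
    wedge μ = b.det μ • wedge b := by
  have h : wedgeMap V k = (LinearMap.toSpanSingleton ℂ (Form V) (wedge b)).compAlternatingMap
      b.det := by
    refine Basis.ext_alternating b fun v hv => ?_
    obtain ⟨σ, rfl⟩ : ∃ σ : Equiv.Perm (Fin k), v = σ :=
      ⟨Equiv.ofBijective v (Finite.injective_iff_bijective.mp hv), rfl⟩
    have h1 := (wedgeMap V k).map_perm b σ
    have h2 := b.det.map_perm b σ
    simp only [Function.comp_def] at h1 h2
    rw [LinearMap.compAlternatingMap_apply, h1, h2, b.det_self, wedgeMap_apply,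
      LinearMap.toSpanSingleton_apply]
    rcases Int.units_eq_one_or (Equiv.Perm.sign σ) with h | h <;> simp [h]
  rw [← wedgeMap_apply, h]; rfl

theorem exists_eq_smul_wedge {k : ℕ} (b : Basis (Fin k) ℂ (Dual ℂ V)) {ψ : Form V}
    (hψ : ψ ∈ pqForms V k 0) : ∃ c : ℂ, ψ = c • wedge b := by
  induction hψ using Submodule.span_induction with
  | mem x hx =>
    obtain ⟨μ, ν, rfl⟩ := hx
    exact ⟨b.det μ, by rw [wedge_of_zero ν, map_one, mul_one, wedge_eq_det_smul b]⟩
  | zero => exact ⟨0, by rw [zero_smul]⟩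
  | add x y _ _ hx hy =>
    obtain ⟨c, rfl⟩ := hx; obtain ⟨d, rfl⟩ := hy
    exact ⟨c + d, by rw [add_smul]⟩
  | smul a x _ hx =>
    obtain ⟨c, rfl⟩ := hx
    exact ⟨a * c, by rw [mul_smul]⟩

end Wedge

/-! ### The forms `i^{k²} ψ∧ψ̄` and positivity in top degree. -/

section Square

variable {V : Type*} [AddCommGroup V] [Module ℂ V]

/-- The real `(k,k)`-form `i^{k²} ψ ∧ ψ̄` of a `(k,0)`-form `ψ`. -/
noncomputable def absSq (k : ℕ) (ψ : Form V) : Form V := Complex.I ^ (k ^ 2) • (ψ * conj V ψ)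

theorem absSq_mem_pqForms {k : ℕ} {ψ : Form V} (hψ : ψ ∈ pqForms V k 0) :
    absSq k ψ ∈ pqForms V k k :=
  Submodule.smul_mem _ _
    (mem_pqForms_of_eq (mul_mem_pqForms hψ (conj_mem_pqForms hψ)) (add_zero k) (zero_add k))

theorem I_pow_sq_mul_neg_one_pow (a : ℕ) :
    (-Complex.I) ^ (a ^ 2) * (-1 : ℂ) ^ (a * a) = Complex.I ^ (a ^ 2) := by
  rw [sq, ← mul_pow]; simp

theorem conj_absSq {k : ℕ} {ψ : Form V} (hψ : ψ ∈ pqForms V k 0) : conj V (absSq k ψ) = absSq k ψ := by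
  rw [absSq, conj_smul, map_mul, conj_conj, mul_comm_of_mem_pqForms (conj_mem_pqForms hψ) hψ,
    smul_smul, map_pow, Complex.conj_I, zero_add, add_zero, I_pow_sq_mul_neg_one_pow]

theorem absSq_mem_realForms {k : ℕ} {ψ : Form V} (hψ : ψ ∈ pqForms V k 0) :
    absSq k ψ ∈ realForms V k :=
  ⟨absSq_mem_pqForms hψ, conj_absSq hψ⟩

/-- Moving `ψ̄` past `χ` costs `(-1)^{ab} = i^{2ab}`, exactly the factor between `i^{a²+b²}` and
`i^{(a+b)²}`. This is the reason for the normalization `i^{k²}`. -/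
theorem absSq_mul_absSq {a b : ℕ} {ψ χ : Form V} (hψ : ψ ∈ pqForms V a 0) (hχ : χ ∈ pqForms V b 0) :
    absSq a ψ * absSq b χ = absSq (a + b) (ψ * χ) := by
  have h := mul_comm_of_mem_pqForms (conj_mem_pqForms hψ) hχ
  rw [absSq, absSq, absSq, smul_mul_smul_comm, mul_assoc ψ, ← mul_assoc (conj V ψ), h, smul_mul_assoc,
    mul_smul_comm, smul_smul, map_mul]
  simp only [mul_assoc]
  congr 1
  have h2 : (-1 : ℂ) ^ ((0 + a) * (b + 0)) = Complex.I ^ (2 * (a * b)) := by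
    rw [pow_mul Complex.I, Complex.I_sq, zero_add, add_zero]
  rw [h2, ← pow_add, ← pow_add]
  congr 1; ring

theorem absSq_smul (k : ℕ) (c : ℂ) (ψ : Form V) :
    absSq k (c • ψ) = ((Complex.normSq c : ℝ) : ℂ) • absSq k ψ := by
  rw [absSq, absSq, conj_smul, smul_mul_smul_comm, Complex.mul_conj, smul_comm]

theorem absSq_zero_one : absSq 0 (1 : Form V) = 1 := by simp [absSq]

theorem absSq_wedge {k : ℕ} (μ : Fin k → Dual ℂ V) :
    (List.ofFn fun j => Complex.I • (oneForm (μ j) * conj V (oneForm (μ j)))).prod =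
      absSq k (wedge μ) := by
  induction k with
  | zero => simp [wedge_of_zero, absSq_zero_one]
  | succ k ih =>
    have h := absSq_mul_absSq (oneForm_mem_pqForms (μ 0)) (wedge_mem_pqForms fun j => μ j.succ)
    rw [List.ofFn_succ, List.prod_cons, ih, wedge_succ]
    rw [add_comm 1 k] at h
    rw [← h]
    simp [absSq]

theorem volForm_eq_absSq (b : Basis (Fin (finrank ℂ V)) ℂ (Dual ℂ V)) :
    volForm b = absSq (finrank ℂ V) (wedge b) := absSq_wedge _

/-- A change of basis multiplies the volume form by `|det|² ≥ 0`, so one basis may be fixed; this is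
what makes positive top forms closed under addition. -/
theorem isPositiveTop_iff (b : Basis (Fin (finrank ℂ V)) ℂ (Dual ℂ V)) (ν : Form V) :
    IsPositiveTop ν ↔ ∃ c : ℝ, 0 ≤ c ∧ ν = (c : ℂ) • absSq (finrank ℂ V) (wedge b) := by
  constructor
  · rintro ⟨b', c, hc, rfl⟩
    refine ⟨c * Complex.normSq (b.det b'), mul_nonneg hc (Complex.normSq_nonneg _), ?_⟩
    rw [volForm_eq_absSq, wedge_eq_det_smul b b', absSq_smul, smul_smul, Complex.ofReal_mul]
  · rintro ⟨c, hc, rfl⟩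
    exact ⟨b, c, hc, by rw [volForm_eq_absSq]⟩

theorem IsPositiveTop.smul {ν : Form V} (hν : IsPositiveTop ν) {r : ℝ} (hr : 0 ≤ r) :
    IsPositiveTop ((r : ℂ) • ν) := by
  obtain ⟨b, c, hc, rfl⟩ := hν
  exact ⟨b, r * c, mul_nonneg hr hc, by rw [smul_smul, Complex.ofReal_mul]⟩

variable [FiniteDimensional ℂ V]

variable (V) in
theorem exists_dual_basis : Nonempty (Basis (Fin (finrank ℂ V)) ℂ (Dual ℂ V)) :=
  ⟨finBasisOfFinrankEq ℂ _ Subspace.dual_finrank_eq⟩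

theorem IsPositiveTop.add {ν τ : Form V} (hν : IsPositiveTop ν) (hτ : IsPositiveTop τ) :
    IsPositiveTop (ν + τ) := by
  obtain ⟨b⟩ := exists_dual_basis V
  obtain ⟨c, hc, rfl⟩ := (isPositiveTop_iff b _).mp hν
  obtain ⟨d, hd, rfl⟩ := (isPositiveTop_iff b _).mp hτ
  exact (isPositiveTop_iff b _).mpr ⟨c + d, add_nonneg hc hd, by
    rw [← add_smul, Complex.ofReal_add]⟩

theorem isPositiveTop_absSq {n : ℕ} (hn : n = finrank ℂ V) {ψ : Form V} (hψ : ψ ∈ pqForms V n 0) :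
    IsPositiveTop (absSq n ψ) := by
  subst hn
  obtain ⟨b⟩ := exists_dual_basis V
  obtain ⟨c, rfl⟩ := exists_eq_smul_wedge b hψ
  exact (isPositiveTop_iff b _).mpr ⟨_, Complex.normSq_nonneg c, absSq_smul _ _ _⟩

end Square

/-! ### Functoriality of pull-back and its compatibility with conjugation and type. -/

section Pullback

variable {V W : Type*} [AddCommGroup V] [Module ℂ V] [AddCommGroup W] [Module ℂ W]

theorem pullback_ι (f : W →ₗ[ℂ] V) (x : V →ₗ[ℝ] ℂ) :
    pullback f (ExteriorAlgebra.ι ℂ x) = ExteriorAlgebra.ι ℂ (x ∘ₗ f.restrictScalars ℝ) :=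
  ExteriorAlgebra.map_apply_ι _ _

theorem pullback_oneForm (f : W →ₗ[ℂ] V) (a : Dual ℂ V) :
    pullback f (oneForm a) = oneForm (a ∘ₗ f) :=
  pullback_ι f _

theorem pullback_conj (f : W →ₗ[ℂ] V) (ω : Form V) :
    pullback f (conj V ω) = conj W (pullback f ω) := by
  induction ω using ExteriorAlgebra.induction with
  | algebraMap r => rw [conj_algebraMap, AlgHom.commutes, AlgHom.commutes, conj_algebraMap]
  | ι x => rw [conj_ι, pullback_ι, pullback_ι, conj_ι]; rfl
  | mul a b ha hb => rw [map_mul, map_mul, map_mul, map_mul, ha, hb]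
  | add a b ha hb => rw [map_add, map_add, map_add, map_add, ha, hb]

theorem pullback_wedge (f : W →ₗ[ℂ] V) {k : ℕ} (μ : Fin k → Dual ℂ V) :
    pullback f (wedge μ) = wedge fun j => μ j ∘ₗ f := by
  induction k with
  | zero => simp [wedge_of_zero]
  | succ k ih => rw [wedge_succ, wedge_succ, map_mul, ih, pullback_oneForm]

theorem pullback_mem_pqForms (f : W →ₗ[ℂ] V) {p q : ℕ} {ω : Form V} (hω : ω ∈ pqForms V p q) :
    pullback f ω ∈ pqForms W p q := by
  induction hω using Submodule.span_induction with
  | mem x hx =>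
    obtain ⟨μ, ν, rfl⟩ := hx
    rw [map_mul, pullback_conj, pullback_wedge, pullback_wedge]
    exact Submodule.subset_span ⟨_, _, rfl⟩
  | zero => rw [map_zero]; exact zero_mem _
  | add x y _ _ hx hy => rw [map_add]; exact add_mem hx hy
  | smul c x _ hx => rw [map_smul]; exact Submodule.smul_mem _ _ hx

theorem pullback_mem_realForms (f : W →ₗ[ℂ] V) {p : ℕ} {ω : Form V} (hω : ω ∈ realForms V p) :
    pullback f ω ∈ realForms W p :=
  ⟨pullback_mem_pqForms f hω.1, by rw [← pullback_conj, hω.2]⟩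

theorem pullback_absSq (f : W →ₗ[ℂ] V) (k : ℕ) (ψ : Form V) :
    pullback f (absSq k ψ) = absSq k (pullback f ψ) := by
  rw [absSq, absSq, map_smul, map_mul, pullback_conj]

theorem pullback_pullback {U : Type*} [AddCommGroup U] [Module ℂ U] (f : W →ₗ[ℂ] V)
    (g : V →ₗ[ℂ] U) (ω : Form U) : pullback f (pullback g ω) = pullback (g ∘ₗ f) ω := by
  induction ω using ExteriorAlgebra.induction with
  | algebraMap r => simp only [AlgHom.commutes]
  | ι x => rw [pullback_ι, pullback_ι, pullback_ι]; rfl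
  | mul a b ha hb => rw [map_mul, map_mul, map_mul, ha, hb]
  | add a b ha hb => rw [map_add, map_add, map_add, ha, hb]

theorem pullback_id (ω : Form V) : pullback LinearMap.id ω = ω := by
  induction ω using ExteriorAlgebra.induction with
  | algebraMap r => simp only [AlgHom.commutes]
  | ι x => rw [pullback_ι]; rfl
  | mul a b ha hb => rw [map_mul, ha, hb]
  | add a b ha hb => rw [map_add, ha, hb]

end Pullback

end PositiveForms

namespace PositiveForms

/-! ### Polarization: decomposable squares span the real `(p,p)`-forms. -/

section Polarization

variable {V : Type*} [AddCommGroup V] [Module ℂ V]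

theorem oneForm_mul_conj_polarization (a b : Dual ℂ V) :
    oneForm a * conj V (oneForm b) =
      (-Complex.I / 4) • (absSq 1 (oneForm (a + b)) - absSq 1 (oneForm (a - b))) +
        (1 / 4 : ℂ) • (absSq 1 (oneForm (a + Complex.I • b)) -
          absSq 1 (oneForm (a - Complex.I • b))) := by
  have e1 : oneForm (a - b) = oneForm a - oneForm b := by
    rw [sub_eq_add_neg, ← neg_one_smul ℂ b, oneForm_add, oneForm_smul, neg_one_smul,
      sub_eq_add_neg]
  have e2 : oneForm (a - Complex.I • b) = oneForm a - Complex.I • oneForm b := by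
    rw [sub_eq_add_neg, ← neg_smul, oneForm_add, oneForm_smul, neg_smul, sub_eq_add_neg]
  rw [e1, e2, oneForm_add, oneForm_add, oneForm_smul]
  simp only [absSq, map_add, map_sub, conj_smul, Complex.conj_I, one_pow, pow_one, mul_add,
    add_mul, mul_sub, sub_mul, smul_mul_assoc, mul_smul_comm]
  generalize oneForm a * conj V (oneForm a) = x
  generalize oneForm a * conj V (oneForm b) = y
  generalize oneForm b * conj V (oneForm a) = z
  generalize oneForm b * conj V (oneForm b) = w
  have hI : Complex.I * Complex.I = -1 := Complex.I_mul_I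
  match_scalars <;> first | ring1 | linear_combination hI

/-- By induction on `k`: one `(1,1)`-factor `μ₀∧ν̄₀` is split off and polarized into four squares,
and the product of a square of a covector with a decomposable square is again one. -/
theorem wedge_mul_conj_wedge_mem_span {k : ℕ} (μ ν : Fin k → Dual ℂ V) :
    wedge μ * conj V (wedge ν) ∈
      Submodule.span ℂ (Set.range fun χ : Fin k → Dual ℂ V => absSq k (wedge χ)) := by
  induction k with
  | zero =>
    refine Submodule.subset_span ⟨μ, ?_⟩
    simp [wedge_of_zero, absSq_zero_one]
  | succ k ih =>
    have key : ∀ a : Dual ℂ V, ∀ ω ∈ Submodule.span ℂ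
        (Set.range fun χ : Fin k → Dual ℂ V => absSq k (wedge χ)),
        absSq 1 (oneForm a) * ω ∈ Submodule.span ℂ
          (Set.range fun χ : Fin (k + 1) → Dual ℂ V => absSq (k + 1) (wedge χ)) := by
      intro a ω hω
      induction hω using Submodule.span_induction with
      | mem x hx =>
        obtain ⟨χ, rfl⟩ := hx
        refine Submodule.subset_span ⟨Fin.cons a χ, ?_⟩
        change absSq (k + 1) _ = absSq 1 _ * absSq k _
        rw [absSq_mul_absSq (oneForm_mem_pqForms a) (wedge_mem_pqForms χ), wedge_cons,
          add_comm k 1]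
      | zero => rw [mul_zero]; exact zero_mem _
      | add x y _ _ hx hy => rw [mul_add]; exact add_mem hx hy
      | smul c x _ hx => rw [mul_smul_comm]; exact Submodule.smul_mem _ _ hx
    -- The sign comes from moving `ν̄₀` past the remaining `k` covectors of `μ`.
    have h : wedge μ * conj V (wedge ν) = (-1 : ℂ) ^ k •
        (oneForm (μ 0) * conj V (oneForm (ν 0)) *
          (wedge (fun j => μ j.succ) * conj V (wedge fun j => ν j.succ))) := by
      have hc := mul_comm_of_mem_degForms (wedge_mem_degForms fun j => μ j.succ)
        (conj_mem_degForms (ι_mem_degForms ((ν 0).restrictScalars ℝ)))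
      rw [mul_one] at hc
      change _ * conj V (oneForm (ν 0)) = _ • (conj V (oneForm (ν 0)) * _) at hc
      rw [wedge_succ, wedge_succ, map_mul, mul_assoc, ← mul_assoc (wedge _), hc]
      simp only [smul_mul_assoc, mul_smul_comm, mul_assoc]
    rw [h, oneForm_mul_conj_polarization]
    refine Submodule.smul_mem _ _ ?_
    rw [add_mul, smul_mul_assoc, smul_mul_assoc, sub_mul, sub_mul]
    have hm := ih (fun j => μ j.succ) (fun j => ν j.succ)
    exact add_mem (Submodule.smul_mem _ _ (sub_mem (key _ _ hm) (key _ _ hm)))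
      (Submodule.smul_mem _ _ (sub_mem (key _ _ hm) (key _ _ hm)))

theorem pqForms_le_span_absSq (p : ℕ) : pqForms V p p ≤
    Submodule.span ℂ (Set.range fun χ : Fin p → Dual ℂ V => absSq p (wedge χ)) :=
  Submodule.span_le.mpr fun _ ⟨μ, ν, h⟩ => h ▸ wedge_mul_conj_wedge_mem_span μ ν

theorem realForms_le_span_absSq (p : ℕ) : realForms V p ≤
    Submodule.span ℝ (Set.range fun χ : Fin p → Dual ℂ V => absSq p (wedge χ)) := by
  have key : ∀ ω ∈ Submodule.span ℂ (Set.range fun χ : Fin p → Dual ℂ V => absSq p (wedge χ)),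
      ω + conj V ω ∈
        Submodule.span ℝ (Set.range fun χ : Fin p → Dual ℂ V => absSq p (wedge χ)) := by
    -- The scalar `c` is quantified inside the induction because `ω ↦ ω + ω̄` is only real-linear.
    have hmem : ∀ ω ∈ Submodule.span ℂ
        (Set.range fun χ : Fin p → Dual ℂ V => absSq p (wedge χ)), ∀ c : ℂ,
        c • ω + conj V (c • ω) ∈
        Submodule.span ℝ (Set.range fun χ : Fin p → Dual ℂ V => absSq p (wedge χ)) := by
      intro ω hω
      induction hω using Submodule.span_induction with
      | mem x hx =>
        intro c
        obtain ⟨χ, rfl⟩ := hx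
        dsimp only
        rw [conj_smul, conj_absSq (wedge_mem_pqForms χ), ← add_smul, Complex.add_conj]
        exact Submodule.smul_mem _ (2 * c.re : ℝ) (Submodule.subset_span ⟨χ, rfl⟩)
      | zero => intro c; rw [smul_zero, map_zero, add_zero]; exact zero_mem _
      | add x y _ _ hx hy =>
        intro c
        rw [smul_add, map_add, add_add_add_comm]
        exact add_mem (hx c) (hy c)
      | smul a x _ hx => intro c; rw [smul_smul]; exact hx _
    intro ω hω
    simpa using hmem ω hω 1
  intro ω hω
  -- For real `ω` this says that `2ω` lies in the real span.
  have h := key ω (pqForms_le_span_absSq p hω.1)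
  rw [hω.2, ← two_smul ℝ] at h
  have h2 := Submodule.smul_mem _ (2⁻¹ : ℝ) h
  rwa [smul_smul, inv_mul_cancel₀ two_ne_zero, one_smul] at h2

end Polarization

/-! ### Splittings `V = W ⊕ ℂe` and the algebra of components. -/

/-- A splitting `V = W ⊕ ℂ e`, with the projections to the two summands. -/
structure LineSplitting (V W : Type*) [AddCommGroup V] [Module ℂ V] [AddCommGroup W]
    [Module ℂ W] where
  incl : W →ₗ[ℂ] V
  proj : V →ₗ[ℂ] W
  coord : Dual ℂ V
  vec : V
  proj_incl : ∀ w, proj (incl w) = w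
  coord_incl : ∀ w, coord (incl w) = 0
  proj_vec : proj vec = 0
  coord_vec : coord vec = 1
  decomp : ∀ v, incl (proj v) + coord v • vec = v

namespace LineSplitting

variable {V W : Type*} [AddCommGroup V] [Module ℂ V] [AddCommGroup W] [Module ℂ W]
variable (s : LineSplitting V W)

/-- The linear equivalence `V ≃ W × ℂ`. -/
noncomputable def equivProd : V ≃ₗ[ℂ] W × ℂ :=
  { s.proj.prod s.coord with
    invFun := fun x => s.incl x.1 + x.2 • s.vec
    left_inv := s.decomp
    right_inv := fun x => by
      ext <;> simp [s.proj_incl, s.coord_incl, s.proj_vec, s.coord_vec] }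

theorem finrank_eq (s : LineSplitting V W) [FiniteDimensional ℂ W] : finrank ℂ V = finrank ℂ W + 1 := by
  rw [s.equivProd.finrank_eq, finrank_prod, finrank_self]

/-- Extension of forms from `W` to `V`. -/
noncomputable abbrev ext : Form W →ₐ[ℂ] Form V := pullback s.proj

/-- Restriction of forms from `V` to `W`. -/
noncomputable abbrev res : Form V →ₐ[ℂ] Form W := pullback s.incl

/-- The `(1,0)`-form of the coordinate along `e`. -/
noncomputable abbrev form : Form V := oneForm s.coord

/-- The positive `(1,1)`-form of the coordinate along `e`. -/
noncomputable abbrev form₂ : Form V := absSq 1 s.form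

theorem form₂_eq : s.form₂ = Complex.I • (s.form * conj V s.form) := by simp [absSq]

theorem res_ext (ω : Form W) : s.res (s.ext ω) = ω := by
  rw [pullback_pullback, show s.proj ∘ₗ s.incl = LinearMap.id from LinearMap.ext s.proj_incl,
    pullback_id]

theorem res_form : s.res s.form = 0 := by
  rw [pullback_oneForm, show s.coord ∘ₗ s.incl = 0 from LinearMap.ext s.coord_incl]
  exact map_zero (ExteriorAlgebra.ι ℂ)

theorem res_conj_form : s.res (conj V s.form) = 0 := by
  rw [pullback_conj, res_form, map_zero]

/-- The form with components `ξ`, `η`, `ζ`, `θ` with respect to the splitting. -/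
noncomputable def comb (ξ η ζ θ : Form W) : Form V :=
  s.ext ξ + s.form * s.ext η + conj V s.form * s.ext ζ + s.form₂ * s.ext θ

theorem conj_form_sq : conj V s.form * conj V s.form = 0 := by
  rw [← map_mul, oneForm_sq, map_zero]

theorem commute_form₂ (ω : Form V) : Commute s.form₂ ω :=
  commute_of_mem_pqForms (absSq_mem_pqForms (oneForm_mem_pqForms _)) ω

theorem form₂_mul_form : s.form₂ * s.form = 0 := by
  rw [(s.commute_form₂ _).eq, form₂_eq, mul_smul_comm, ← mul_assoc, oneForm_sq, zero_mul,
    smul_zero]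

theorem form₂_mul_conj_form : s.form₂ * conj V s.form = 0 := by
  rw [form₂_eq, smul_mul_assoc, mul_assoc, conj_form_sq, mul_zero, smul_zero]

theorem form₂_mul_form₂ : s.form₂ * s.form₂ = 0 := by
  nth_rw 2 [form₂_eq]
  rw [mul_smul_comm, ← mul_assoc, form₂_mul_form, zero_mul, smul_zero]

/-- With `γ∧η` and `γ̄∧ζ` absent from the first factor, the products that could mix components all
contain `iγ∧γ̄` multiplied by `γ`, `γ̄` or itself, and vanish. -/
theorem comb_mul_comb {ξ : Form W} (hξ : ∀ ω : Form V, Commute (s.ext ξ) ω) (θ A B C D : Form W) :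
    s.comb ξ 0 0 θ * s.comb A B C D = s.comb (ξ * A) (ξ * B) (ξ * C) (ξ * D + θ * A) := by
  simp only [comb, map_zero, mul_zero, add_zero, map_mul, map_add, mul_add, add_mul]
  have h1 : s.ext ξ * (s.form * s.ext B) = s.form * (s.ext ξ * s.ext B) := by
    rw [← mul_assoc, (hξ _).eq, mul_assoc]
  have h2 : s.ext ξ * (conj V s.form * s.ext C) = conj V s.form * (s.ext ξ * s.ext C) := by
    rw [← mul_assoc, (hξ _).eq, mul_assoc]
  have h3 : s.ext ξ * (s.form₂ * s.ext D) = s.form₂ * (s.ext ξ * s.ext D) := by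
    rw [← mul_assoc, (hξ _).eq, mul_assoc]
  have hc : s.form₂ * s.ext θ = s.ext θ * s.form₂ := (s.commute_form₂ _).eq
  have h4 : s.form₂ * s.ext θ * (s.form * s.ext B) = 0 := by
    rw [hc, mul_assoc, ← mul_assoc s.form₂, form₂_mul_form, zero_mul, mul_zero]
  have h5 : s.form₂ * s.ext θ * (conj V s.form * s.ext C) = 0 := by
    rw [hc, mul_assoc, ← mul_assoc s.form₂, form₂_mul_conj_form, zero_mul, mul_zero]
  have h6 : s.form₂ * s.ext θ * (s.form₂ * s.ext D) = 0 := by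
    rw [hc, mul_assoc, ← mul_assoc s.form₂, form₂_mul_form₂, zero_mul, mul_zero]
  rw [h1, h2, h3, h4, h5, h6, mul_assoc s.form₂]
  abel

theorem comb_mul_ext (ξ η ζ θ A : Form W) :
    s.comb ξ η ζ θ * s.ext A = s.comb (ξ * A) (η * A) (ζ * A) (θ * A) := by
  simp only [comb, map_mul, add_mul, mul_assoc]

theorem comb_mul_form₂ (ξ η ζ θ : Form W) :
    s.comb ξ η ζ θ * s.form₂ = s.comb 0 0 0 ξ := by
  rw [← (s.commute_form₂ _).eq]
  simp only [comb, mul_add, ← mul_assoc, form₂_mul_form, form₂_mul_conj_form, form₂_mul_form₂,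
    zero_mul, add_zero, map_zero, mul_zero, zero_add]

theorem comb_add (ξ η ζ θ ξ' η' ζ' θ' : Form W) :
    s.comb ξ η ζ θ + s.comb ξ' η' ζ' θ' = s.comb (ξ + ξ') (η + η') (ζ + ζ') (θ + θ') := by
  simp only [comb, map_add, mul_add]; abel

theorem comb_smul (c : ℂ) (ξ η ζ θ : Form W) :
    c • s.comb ξ η ζ θ = s.comb (c • ξ) (c • η) (c • ζ) (c • θ) := by
  simp only [comb, smul_add, map_smul, mul_smul_comm]

theorem comb_zero_left (θ : Form W) : s.comb 0 0 0 θ = s.form₂ * s.ext θ := by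
  simp only [comb, map_zero, mul_zero, zero_add]

theorem conj_form₂ : conj V s.form₂ = s.form₂ := conj_absSq (oneForm_mem_pqForms _)

theorem conj_comb (ξ η ζ θ : Form W) :
    conj V (s.comb ξ η ζ θ) = s.comb (conj W ξ) (conj W ζ) (conj W η) (conj W θ) := by
  simp only [comb, map_add, map_mul, conj_conj, conj_form₂, ← pullback_conj]
  abel

/-- The components of a square: the diagonal ones are the squares of `A` and `B`, and only the mixed
ones change sign under `B ↦ -B`. -/
theorem ext_add_form_mul_ext_sq {q : ℕ} {A B : Form W} (hA : A ∈ pqForms W (q + 1) 0)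
    (hB : B ∈ pqForms W q 0) :
    absSq (q + 1) (s.ext A + s.form * s.ext B) =
      s.comb (absSq (q + 1) A) (Complex.I ^ ((q + 1) ^ 2) • (B * conj W A))
        (Complex.I ^ ((q + 1) ^ 2) • (-1 : ℂ) ^ (q + 1) • (A * conj W B)) (absSq q B) := by
  have h1 : Complex.I ^ ((q + 1) ^ 2) • (s.form * s.ext B * (conj V (s.form * s.ext B))) =
      s.form₂ * s.ext (absSq q B) := by
    rw [pullback_absSq, absSq_mul_absSq (oneForm_mem_pqForms _) (pullback_mem_pqForms _ hB),
      add_comm 1 q]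
    rfl
  have h2 : s.ext A * conj V s.form = (-1 : ℂ) ^ (q + 1) • (conj V s.form * s.ext A) := by
    have := mul_comm_of_mem_pqForms (pullback_mem_pqForms s.proj hA)
      (conj_mem_pqForms (oneForm_mem_pqForms s.coord))
    simpa using this
  rw [comb, ← h1, map_smul, map_smul, map_smul, map_mul, map_mul, pullback_absSq]
  simp only [absSq]
  rw [pullback_conj, pullback_conj, map_add, map_mul]
  simp only [mul_add, add_mul, smul_add]
  rw [← mul_assoc (s.ext A), h2, smul_mul_assoc, mul_smul_comm, mul_smul_comm, mul_smul_comm,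
    mul_assoc, mul_assoc]
  generalize (-1 : ℂ) ^ (q + 1) = c
  abel

/-! ### Recovering the components by contraction. -/

section Contraction

/-- The `(1,0)`-part of evaluation of covectors at a vector. -/
noncomputable def evalHol (e : V) : Dual ℂ (V →ₗ[ℝ] ℂ) where
  toFun φ := (φ e - Complex.I * φ (Complex.I • e)) / 2
  map_add' φ ψ := by simp only [LinearMap.add_apply]; ring
  map_smul' c φ := by simp only [LinearMap.smul_apply, smul_eq_mul, RingHom.id_apply]; ring

/-- The `(0,1)`-part of evaluation of covectors at a vector. -/
noncomputable def evalAntihol (e : V) : Dual ℂ (V →ₗ[ℝ] ℂ) where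
  toFun φ := (φ e + Complex.I * φ (Complex.I • e)) / 2
  map_add' φ ψ := by simp only [LinearMap.add_apply]; ring
  map_smul' c φ := by simp only [LinearMap.smul_apply, smul_eq_mul, RingHom.id_apply]; ring

/-- Contraction of forms with a covector functional. -/
noncomputable def contract (d : Dual ℂ (V →ₗ[ℝ] ℂ)) : Form V →ₗ[ℂ] Form V :=
  CliffordAlgebra.contractLeft d

theorem contract_ι_mul (d : Dual ℂ (V →ₗ[ℝ] ℂ)) (a : V →ₗ[ℝ] ℂ) (ω : Form V) :
    contract d (ExteriorAlgebra.ι ℂ a * ω) =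
      d a • ω - ExteriorAlgebra.ι ℂ a * contract d ω :=
  CliffordAlgebra.contractLeft_ι_mul _ _ _

theorem contract_ext {d : Dual ℂ (V →ₗ[ℝ] ℂ)}
    (hd : ∀ φ : W →ₗ[ℝ] ℂ, d (φ ∘ₗ s.proj.restrictScalars ℝ) = 0) (ω : Form W) :
    contract d (s.ext ω) = 0 := by
  -- Contraction has a usable product rule only for a covector on the left, so the induction shows
  -- that left multiplication by `ω` preserves vanishing; `τ = 1` gives the claim.
  have key : ∀ ω τ : Form W, contract d (s.ext τ) = 0 → contract d (s.ext (ω * τ)) = 0 := by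
    intro ω
    induction ω using ExteriorAlgebra.induction with
    | algebraMap r =>
      intro τ hτ
      rw [← Algebra.smul_def, map_smul, map_smul, hτ, smul_zero]
    | ι x => intro τ hτ; rw [map_mul, pullback_ι, contract_ι_mul, hd, hτ]; simp
    | mul a b ha hb => intro τ hτ; rw [mul_assoc]; exact ha _ (hb _ hτ)
    | add a b ha hb => intro τ hτ; rw [add_mul, map_add, map_add, ha _ hτ, hb _ hτ, add_zero]
  have := key ω 1 (by
    rw [map_one]; exact CliffordAlgebra.contractLeft_one (Q := (0 : QuadraticForm ℂ (V →ₗ[ℝ] ℂ))) d)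
  rwa [mul_one] at this

theorem contract_hol_form_mul (ω : Form V) :
    contract (evalHol s.vec) (s.form * ω) = ω - s.form * contract (evalHol s.vec) ω := by
  have h : evalHol s.vec (s.coord.restrictScalars ℝ) = 1 := by
    simp [evalHol, s.coord_vec]
  rw [show s.form = ExteriorAlgebra.ι ℂ (s.coord.restrictScalars ℝ) from rfl,
    contract_ι_mul, h, one_smul]

theorem contract_hol_conj_form_mul (ω : Form V) :
    contract (evalHol s.vec) (conj V s.form * ω) =
      -(conj V s.form * contract (evalHol s.vec) ω) := by
  have h : evalHol s.vec (conjCovector (s.coord.restrictScalars ℝ)) = 0 := by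
    simp [evalHol, conjCovector, s.coord_vec]
  rw [show s.form = ExteriorAlgebra.ι ℂ (s.coord.restrictScalars ℝ) from rfl, conj_ι,
    contract_ι_mul, h, zero_smul, zero_sub]

theorem contract_antihol_conj_form_mul (ω : Form V) :
    contract (evalAntihol s.vec) (conj V s.form * ω) =
      ω - conj V s.form * contract (evalAntihol s.vec) ω := by
  have h : evalAntihol s.vec (conjCovector (s.coord.restrictScalars ℝ)) = 1 := by
    simp [evalAntihol, conjCovector, s.coord_vec]
  rw [show s.form = ExteriorAlgebra.ι ℂ (s.coord.restrictScalars ℝ) from rfl, conj_ι,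
    contract_ι_mul, h, one_smul]

theorem contract_hol_ext (ω : Form W) : contract (evalHol s.vec) (s.ext ω) = 0 := by
  refine s.contract_ext (fun φ => ?_) ω
  simp [evalHol, s.proj_vec]

theorem contract_antihol_ext (ω : Form W) : contract (evalAntihol s.vec) (s.ext ω) = 0 := by
  refine s.contract_ext (fun φ => ?_) ω
  simp [evalAntihol, s.proj_vec]

/-- The component `η` of `ξ + γ ∧ η + γ̄ ∧ ζ + i γ ∧ γ̄ ∧ θ`. -/
noncomputable def fiberHol : Form V →ₗ[ℂ] Form W :=
  s.res.toLinearMap ∘ₗ contract (evalHol s.vec)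

/-- The component `θ` of `ξ + γ ∧ η + γ̄ ∧ ζ + i γ ∧ γ̄ ∧ θ`. -/
noncomputable def fiber : Form V →ₗ[ℂ] Form W :=
  (-Complex.I) • (s.res.toLinearMap ∘ₗ contract (evalAntihol s.vec) ∘ₗ contract (evalHol s.vec))

theorem contract_hol_comb (ξ η ζ θ : Form W) : contract (evalHol s.vec) (s.comb ξ η ζ θ) =
    s.ext η + Complex.I • (conj V s.form * s.ext θ) := by
  rw [comb, form₂_eq, map_add, map_add, map_add, contract_hol_ext, contract_hol_form_mul,
    contract_hol_ext, contract_hol_conj_form_mul, contract_hol_ext, smul_mul_assoc, map_smul,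
    mul_assoc, contract_hol_form_mul, contract_hol_conj_form_mul, contract_hol_ext]
  simp

theorem res_comb (ξ η ζ θ : Form W) : s.res (s.comb ξ η ζ θ) = ξ := by
  rw [comb, form₂_eq]
  simp only [map_add, map_mul, map_smul, res_form, res_conj_form, res_ext, zero_mul, smul_zero,
    add_zero]

theorem fiberHol_comb (ξ η ζ θ : Form W) : s.fiberHol (s.comb ξ η ζ θ) = η := by
  rw [fiberHol, LinearMap.comp_apply, contract_hol_comb]
  simp only [AlgHom.toLinearMap_apply, map_add, map_mul, map_smul, res_conj_form, res_ext,
    zero_mul, smul_zero, add_zero]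

theorem fiber_comb (ξ η ζ θ : Form W) : s.fiber (s.comb ξ η ζ θ) = θ := by
  rw [fiber, LinearMap.smul_apply, LinearMap.comp_apply, LinearMap.comp_apply, contract_hol_comb,
    map_add, contract_antihol_ext, map_smul, contract_antihol_conj_form_mul,
    contract_antihol_ext, mul_zero, sub_zero, zero_add, map_smul, AlgHom.toLinearMap_apply,
    res_ext, smul_smul]
  simp

end Contraction

end LineSplitting

end PositiveForms

namespace PositiveForms

/-! ### Existence of components, and positivity of top forms along a splitting. -/

namespace LineSplitting

variable {V W : Type*} [AddCommGroup V] [Module ℂ V] [AddCommGroup W] [Module ℂ W]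
variable (s : LineSplitting V W)

theorem eq_comp_proj_add (a : Dual ℂ V) :
    a = (a ∘ₗ s.incl) ∘ₗ s.proj + a s.vec • s.coord := by
  ext v
  conv_lhs => rw [← s.decomp v, map_add, map_smul]
  simp [mul_comm]

theorem exists_oneForm_eq (a : Dual ℂ V) :
    ∃ (β : Dual ℂ W) (c : ℂ), oneForm a = s.ext (oneForm β) + c • s.form :=
  ⟨a ∘ₗ s.incl, a s.vec, by
    conv_lhs => rw [s.eq_comp_proj_add a, oneForm_add, oneForm_smul]
    rw [pullback_oneForm]⟩

/-- A decomposable form has a factorization in which all factors but one are extended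
from `W`. -/
theorem exists_wedge_eq {k : ℕ} (μ : Fin (k + 1) → Dual ℂ V) :
    ∃ (β : Dual ℂ W) (c : ℂ) (χ : Fin k → Dual ℂ W),
      wedge μ = (s.ext (oneForm β) + c • s.form) * s.ext (wedge χ) := by
  induction k with
  | zero =>
    obtain ⟨β, c, h⟩ := s.exists_oneForm_eq (μ 0)
    exact ⟨β, c, Fin.elim0, by rw [wedge_succ, wedge_of_zero, wedge_of_zero, map_one, h]⟩
  | succ k ih =>
    obtain ⟨β₀, c₀, h₀⟩ := s.exists_oneForm_eq (μ 0)
    obtain ⟨β₁, c₁, χ, h₁⟩ := ih fun j => μ j.succ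
    by_cases hc : c₁ = 0
    · refine ⟨β₀, c₀, Fin.cons β₁ χ, ?_⟩
      rw [wedge_succ, h₀, h₁, hc, zero_smul, add_zero, wedge_cons, map_mul]
    -- Subtracting `c₀/c₁` times the second factor from the first does not change the product and
    -- removes `γ` from it. Swapping the two factors then puts the one containing `γ` in front; the
    -- sign is absorbed into it.
    · refine ⟨-β₁, -c₁, Fin.cons (β₀ - (c₀ / c₁) • β₁) χ, ?_⟩
      have e₀ : oneForm (-β₁) = -oneForm β₁ := by
        rw [← neg_one_smul ℂ β₁, oneForm_smul, neg_one_smul]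
      have e₁ : oneForm (β₀ - (c₀ / c₁) • β₁) = oneForm β₀ - (c₀ / c₁) • oneForm β₁ := by
        rw [sub_eq_add_neg, ← neg_smul, oneForm_add, oneForm_smul, neg_smul, sub_eq_add_neg]
      have e₂ : c₀ • s.form = (c₀ / c₁) • (c₁ • s.form) := by
        rw [smul_smul, div_mul_cancel₀ _ hc]
      have anti : s.form * s.ext (oneForm β₀) = -(s.ext (oneForm β₀) * s.form) := by
        rw [pullback_oneForm]
        exact eq_neg_of_add_eq_zero_left (ExteriorAlgebra.ι_add_mul_swap _ _)
      have anti' : s.form * s.ext (oneForm β₁) = -(s.ext (oneForm β₁) * s.form) := by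
        rw [pullback_oneForm]
        exact eq_neg_of_add_eq_zero_left (ExteriorAlgebra.ι_add_mul_swap _ _)
      have anti'' : s.ext (oneForm β₁) * s.ext (oneForm β₀) =
          -(s.ext (oneForm β₀) * s.ext (oneForm β₁)) := by
        rw [← map_mul, ← map_mul, ← map_neg]
        exact congrArg _ (eq_neg_of_add_eq_zero_left (ExteriorAlgebra.ι_add_mul_swap _ _))
      have sq₀ : s.ext (oneForm β₁) * s.ext (oneForm β₁) = 0 := by
        rw [← map_mul, oneForm_sq, map_zero]
      have sq₁ : s.form * s.form = 0 := oneForm_sq _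
      rw [wedge_succ, h₀, h₁, wedge_cons, map_mul, ← mul_assoc, ← mul_assoc, e₀, e₁, map_neg,
        map_sub, map_smul, e₂]
      congr 1
      simp only [mul_add, add_mul, mul_sub, smul_mul_assoc, mul_smul_comm, neg_mul, neg_smul, anti,
        anti', anti'', sq₀, sq₁]
      module

theorem exists_holomorphic_eq {k : ℕ} {ψ : Form V} (hψ : ψ ∈ pqForms V (k + 1) 0) :
    ∃ A ∈ pqForms W (k + 1) 0, ∃ B ∈ pqForms W k 0, ψ = s.ext A + s.form * s.ext B := by
  induction hψ using Submodule.span_induction with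
  | mem x hx =>
    obtain ⟨μ, ν, rfl⟩ := hx
    obtain ⟨β, c, χ, h⟩ := s.exists_wedge_eq μ
    refine ⟨oneForm β * wedge χ, ?_, c • wedge χ, Submodule.smul_mem _ _ (wedge_mem_pqForms χ), ?_⟩
    · exact mem_pqForms_of_eq (mul_mem_pqForms (oneForm_mem_pqForms β) (wedge_mem_pqForms χ))
        (add_comm 1 k) rfl
    · rw [wedge_of_zero ν, map_one, mul_one, h, add_mul, map_mul, map_smul, smul_mul_assoc,
        mul_smul_comm]
  | zero => exact ⟨0, zero_mem _, 0, zero_mem _, by simp⟩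
  | add x y _ _ hx hy =>
    obtain ⟨A, hA, B, hB, rfl⟩ := hx
    obtain ⟨A', hA', B', hB', rfl⟩ := hy
    exact ⟨A + A', add_mem hA hA', B + B', add_mem hB hB', by
      rw [map_add, map_add, mul_add]; abel⟩
  | smul c x _ hx =>
    obtain ⟨A, hA, B, hB, rfl⟩ := hx
    exact ⟨c • A, Submodule.smul_mem _ _ hA, c • B, Submodule.smul_mem _ _ hB, by
      rw [map_smul, map_smul, mul_smul_comm, smul_add]⟩

theorem exists_eq_ext_of_mem_pqForms_zero {ψ : Form V} (hψ : ψ ∈ pqForms V 0 0) :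
    ∃ A ∈ pqForms W 0 0, ψ = s.ext A := by
  induction hψ using Submodule.span_induction with
  | mem x hx =>
    obtain ⟨μ, ν, rfl⟩ := hx
    exact ⟨wedge Fin.elim0, wedge_mem_pqForms _, by simp [wedge_of_zero]⟩
  | zero => exact ⟨0, zero_mem _, by simp⟩
  | add x y _ _ hx hy =>
    obtain ⟨A, hA, rfl⟩ := hx
    obtain ⟨A', hA', rfl⟩ := hy
    exact ⟨A + A', add_mem hA hA', by rw [map_add]⟩
  | smul c x _ hx =>
    obtain ⟨A, hA, rfl⟩ := hx
    exact ⟨c • A, Submodule.smul_mem _ _ hA, by rw [map_smul]⟩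

/-- By polarization it is enough to treat squares of decomposable forms, whose components are
explicit. -/
theorem exists_eq_comb {p : ℕ} {Ω : Form V} (hΩ : Ω ∈ pqForms V (p + 1) (p + 1)) :
    ∃ ξ ∈ pqForms W (p + 1) (p + 1), ∃ η ∈ pqForms W p (p + 1), ∃ ζ ∈ pqForms W (p + 1) p,
      ∃ θ ∈ pqForms W p p, Ω = s.comb ξ η ζ θ := by
  have h := pqForms_le_span_absSq _ hΩ
  clear hΩ
  induction h using Submodule.span_induction with
  | mem x hx =>
    obtain ⟨χ, rfl⟩ := hx
    obtain ⟨A, hA, B, hB, h⟩ := s.exists_holomorphic_eq (wedge_mem_pqForms χ)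
    exact ⟨_, absSq_mem_pqForms hA,
      Complex.I ^ ((p + 1) ^ 2) • (B * conj W A), Submodule.smul_mem _ _ (mem_pqForms_of_eq
        (mul_mem_pqForms hB (conj_mem_pqForms hA)) (add_zero _) (zero_add _)),
      Complex.I ^ ((p + 1) ^ 2) • (-1 : ℂ) ^ (p + 1) • (A * conj W B),
      Submodule.smul_mem _ _ (Submodule.smul_mem _ _ (mem_pqForms_of_eq
        (mul_mem_pqForms hA (conj_mem_pqForms hB)) (add_zero _) (zero_add _))),
      _, absSq_mem_pqForms hB, by
        dsimp only
        rw [h, s.ext_add_form_mul_ext_sq hA hB]⟩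
  | zero => exact ⟨0, zero_mem _, 0, zero_mem _, 0, zero_mem _, 0, zero_mem _, by simp [comb]⟩
  | add x y _ _ hx hy =>
    obtain ⟨a, ha, b, hb, c, hc, d, hd, rfl⟩ := hx
    obtain ⟨a', ha', b', hb', c', hc', d', hd', rfl⟩ := hy
    exact ⟨a + a', add_mem ha ha', b + b', add_mem hb hb', c + c', add_mem hc hc', d + d',
      add_mem hd hd', s.comb_add _ _ _ _ _ _ _ _⟩
  | smul r x _ hx =>
    obtain ⟨a, ha, b, hb, c, hc, d, hd, rfl⟩ := hx
    exact ⟨r • a, Submodule.smul_mem _ _ ha, r • b, Submodule.smul_mem _ _ hb, r • c,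
      Submodule.smul_mem _ _ hc, r • d, Submodule.smul_mem _ _ hd, s.comb_smul _ _ _ _ _⟩

theorem comb_mem_pqForms {p : ℕ} {ξ η ζ θ : Form W} (hξ : ξ ∈ pqForms W (p + 1) (p + 1))
    (hη : η ∈ pqForms W p (p + 1)) (hζ : ζ ∈ pqForms W (p + 1) p) (hθ : θ ∈ pqForms W p p) :
    s.comb ξ η ζ θ ∈ pqForms V (p + 1) (p + 1) := by
  have hf : s.form ∈ pqForms V 1 0 := oneForm_mem_pqForms _
  refine add_mem (add_mem (add_mem ?_ ?_) ?_) ?_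
  · exact pullback_mem_pqForms _ hξ
  · exact mem_pqForms_of_eq (mul_mem_pqForms hf (pullback_mem_pqForms _ hη)) (by ring) (by ring)
  · exact mem_pqForms_of_eq (mul_mem_pqForms (conj_mem_pqForms hf) (pullback_mem_pqForms _ hζ))
      (by ring) (by ring)
  · exact mem_pqForms_of_eq (mul_mem_pqForms (absSq_mem_pqForms hf) (pullback_mem_pqForms _ hθ))
      (by ring) (by ring)

theorem comb_mem_realForms {p : ℕ} {ξ θ : Form W} (hξ : ξ ∈ realForms W (p + 1))
    (hθ : θ ∈ realForms W p) : s.comb ξ 0 0 θ ∈ realForms V (p + 1) :=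
  ⟨s.comb_mem_pqForms hξ.1 (zero_mem _) (zero_mem _) hθ.1, by
    rw [conj_comb, hξ.2, hθ.2, map_zero]⟩

theorem fiber_mem_realForms {p : ℕ} {Ω : Form V} (hΩ : Ω ∈ realForms V (p + 1)) :
    s.fiber Ω ∈ realForms W p := by
  obtain ⟨ξ, hξ, η, hη, ζ, hζ, θ, hθ, h⟩ := s.exists_eq_comb hΩ.1
  have h2 := hΩ.2
  rw [h, conj_comb] at h2
  have h3 := congrArg s.fiber h2
  rw [fiber_comb, fiber_comb] at h3
  rw [h, fiber_comb]
  exact ⟨hθ, h3⟩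

variable [FiniteDimensional ℂ W]

theorem _root_.PositiveForms.IsPositiveTop.fiber {ν : Form V} (h : IsPositiveTop ν) :
    IsPositiveTop (s.fiber ν) := by
  obtain ⟨b, c, hc, rfl⟩ := h
  rw [volForm_eq_absSq, map_smul]
  refine IsPositiveTop.smul ?_ hc
  -- The degree is a variable `n` so that it can be replaced by `dim W + 1`; then the fibre
  -- component is the square of a top-degree form on `W`.
  have key : ∀ n, n = finrank ℂ W + 1 → ∀ ψ ∈ pqForms V n 0,
      IsPositiveTop (s.fiber (absSq n ψ)) := by
    rintro _ rfl ψ hψ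
    obtain ⟨A, hA, B, hB, rfl⟩ := s.exists_holomorphic_eq hψ
    rw [s.ext_add_form_mul_ext_sq hA hB, fiber_comb]
    exact isPositiveTop_absSq rfl hB
  exact key _ s.finrank_eq _ (wedge_mem_pqForms b)

variable [FiniteDimensional ℂ V]

theorem isPositiveTop_form₂_mul_ext {τ : Form W} :
    IsPositiveTop (s.form₂ * s.ext τ) ↔ IsPositiveTop τ := by
  constructor
  · intro h
    have h1 := h.fiber s
    rwa [← comb_zero_left, fiber_comb] at h1
  · rintro ⟨b, c, hc, rfl⟩
    rw [volForm_eq_absSq, map_smul, mul_smul_comm, pullback_absSq]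
    refine IsPositiveTop.smul ?_ hc
    have hb := pullback_mem_pqForms s.proj (wedge_mem_pqForms b)
    rw [absSq_mul_absSq (oneForm_mem_pqForms _) hb]
    exact isPositiveTop_absSq (by rw [s.finrank_eq, add_comm])
      (mul_mem_pqForms_zero (oneForm_mem_pqForms _) hb)

end LineSplitting

/-! ### A uniform description of the three cones, and their convexity. -/

section Cone

variable {V : Type*} [AddCommGroup V] [Module ℂ V]

/-- Products of a scalar and a decomposable form. -/
def scaledWedges (V : Type*) [AddCommGroup V] [Module ℂ V] (q : ℕ) : Set (Form V) :=
  {ψ | ∃ (c : ℂ) (μ : Fin q → Dual ℂ V), ψ = c • wedge μ}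

/-- The forms against which weak and Hermitian positivity are tested; strong positivity is not
tested in this way. -/
def testForms (V : Type*) [AddCommGroup V] [Module ℂ V] : PosType → ℕ → Set (Form V)
  | .hermitian, q => pqForms V q 0
  | _, q => scaledWedges V q

theorem testForms_subset (t : PosType) (q : ℕ) : testForms V t q ⊆ pqForms V q 0 := by
  cases t with
  | hermitian => exact subset_rfl
  | _ =>
    rintro _ ⟨c, μ, rfl⟩
    exact Submodule.smul_mem _ _ (wedge_mem_pqForms μ)

theorem mul_absSq (Ω ψ : Form V) (q : ℕ) :
    Complex.I ^ (q ^ 2) • (Ω * ψ * conj V ψ) = Ω * absSq q ψ := by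
  rw [absSq, mul_smul_comm, mul_assoc]

/-- Weak and Hermitian positivity become a single kind of test. Scalar multiples of decomposable
forms are admitted because in degree `0` a scalar cannot be absorbed into a factor; they change the
square only by `|c|²`. -/
theorem mem_posCone_iff {t : PosType} (ht : t ≠ .strong) {p : ℕ} {Ω : Form V} :
    Ω ∈ posCone V t p ↔ Ω ∈ realForms V p ∧ ∀ q, p + q = finrank ℂ V → ∀ ψ ∈ testForms V t q,
      IsPositiveTop (Ω * absSq q ψ) := by
  cases t with
  | strong => exact absurd rfl ht
  | hermitian => simp only [posCone, mul_absSq, Set.mem_ofPred_eq]; rfl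
  | weak =>
    simp only [posCone, mul_absSq, Set.mem_ofPred_eq]
    refine and_congr_right fun _ => forall₂_congr fun q _ => ⟨?_, ?_⟩
    · rintro h _ ⟨c, μ, rfl⟩
      rw [absSq_smul, mul_smul_comm]
      exact (h μ).smul (Complex.normSq_nonneg c)
    · exact fun h μ => h _ ⟨1, μ, by rw [one_smul]⟩

theorem mem_posCone_strong {p : ℕ} {Ω : Form V} : Ω ∈ posCone V .strong p ↔
    ∃ (m : ℕ) (c : Fin m → ℝ) (μ : Fin m → Fin p → Dual ℂ V), (∀ j, 0 ≤ c j) ∧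
      Ω = ∑ j, (c j : ℂ) • absSq p (wedge (μ j)) := by
  simp only [posCone, Set.mem_ofPred_eq, Finset.smul_sum, absSq, smul_comm (Complex.I ^ (p ^ 2))]

theorem absSq_wedge_mem_strong {p : ℕ} (μ : Fin p → Dual ℂ V) :
    absSq p (wedge μ) ∈ posCone V .strong p :=
  mem_posCone_strong.mpr ⟨1, fun _ => 1, fun _ => μ, fun _ => zero_le_one, by simp⟩

theorem smul_mem_strong {p : ℕ} {Ω : Form V} (hΩ : Ω ∈ posCone V .strong p) {r : ℝ}
    (hr : 0 ≤ r) : (r : ℂ) • Ω ∈ posCone V .strong p := by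
  obtain ⟨m, c, μ, hc, rfl⟩ := mem_posCone_strong.mp hΩ
  refine mem_posCone_strong.mpr ⟨m, fun j => r * c j, μ, fun j => mul_nonneg hr (hc j), ?_⟩
  simp only [Finset.smul_sum, smul_smul, Complex.ofReal_mul]

theorem add_mem_strong {p : ℕ} {Ω Ω' : Form V} (hΩ : Ω ∈ posCone V .strong p)
    (hΩ' : Ω' ∈ posCone V .strong p) : Ω + Ω' ∈ posCone V .strong p := by
  obtain ⟨m, c, μ, hc, rfl⟩ := mem_posCone_strong.mp hΩ
  obtain ⟨m', c', μ', hc', rfl⟩ := mem_posCone_strong.mp hΩ'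
  refine mem_posCone_strong.mpr ⟨m + m', Fin.append c c', Fin.append μ μ', fun j => ?_, ?_⟩
  · refine Fin.addCases (fun i => ?_) (fun i => ?_) j
    · rw [Fin.append_left]; exact hc i
    · rw [Fin.append_right]; exact hc' i
  · rw [Fin.sum_univ_add]
    simp only [Fin.append_left, Fin.append_right]

theorem zero_mem_strong (p : ℕ) : (0 : Form V) ∈ posCone V .strong p :=
  mem_posCone_strong.mpr ⟨0, Fin.elim0, Fin.elim0, fun j => j.elim0, by simp⟩

theorem smul_mem_realForms {p : ℕ} {Ω : Form V} (hΩ : Ω ∈ realForms V p) (r : ℝ) :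
    (r : ℂ) • Ω ∈ realForms V p :=
  (realForms V p).smul_mem r hΩ

/-- Induction principle for strongly positive forms. -/
theorem strong_induction {p : ℕ} {P : Form V → Prop} (h0 : P 0)
    (hadd : ∀ Ω Ω', P Ω → P Ω' → P (Ω + Ω'))
    (hsmul : ∀ (r : ℝ) (μ : Fin p → Dual ℂ V), 0 ≤ r → P ((r : ℂ) • absSq p (wedge μ)))
    {Ω : Form V} (hΩ : Ω ∈ posCone V .strong p) : P Ω := by
  obtain ⟨m, c, μ, hc, rfl⟩ := mem_posCone_strong.mp hΩ
  exact Finset.sum_induction _ P hadd h0 fun j _ => hsmul _ _ (hc j)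

theorem posCone_subset_realForms (t : PosType) (p : ℕ) : posCone V t p ⊆ realForms V p := by
  intro Ω hΩ
  by_cases ht : t = .strong
  · subst ht
    refine strong_induction (P := fun Ω => Ω ∈ realForms V p) (zero_mem _)
      (fun _ _ h h' => add_mem h h') (fun r μ _ => ?_) hΩ
    exact smul_mem_realForms (absSq_mem_realForms (wedge_mem_pqForms μ)) r
  · exact ((mem_posCone_iff ht).mp hΩ).1

theorem smul_mem_posCone {t : PosType} {p : ℕ} {Ω : Form V} (hΩ : Ω ∈ posCone V t p) {r : ℝ}
    (hr : 0 ≤ r) : (r : ℂ) • Ω ∈ posCone V t p := by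
  by_cases ht : t = .strong
  · subst ht; exact smul_mem_strong hΩ hr
  · rw [mem_posCone_iff ht] at hΩ ⊢
    refine ⟨smul_mem_realForms hΩ.1 r, fun q hq ψ hψ => ?_⟩
    rw [smul_mul_assoc]
    exact (hΩ.2 q hq ψ hψ).smul hr

variable [FiniteDimensional ℂ V]

theorem add_mem_posCone {t : PosType} {p : ℕ} {Ω Ω' : Form V} (hΩ : Ω ∈ posCone V t p)
    (hΩ' : Ω' ∈ posCone V t p) : Ω + Ω' ∈ posCone V t p := by
  by_cases ht : t = .strong
  · subst ht; exact add_mem_strong hΩ hΩ'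
  · rw [mem_posCone_iff ht] at hΩ hΩ' ⊢
    refine ⟨add_mem hΩ.1 hΩ'.1, fun q hq ψ hψ => ?_⟩
    rw [add_mul]
    exact (hΩ.2 q hq ψ hψ).add (hΩ'.2 q hq ψ hψ)

theorem absSq_wedge_mem_posCone (t : PosType) {p : ℕ} (μ : Fin p → Dual ℂ V) :
    absSq p (wedge μ) ∈ posCone V t p := by
  by_cases ht : t = .strong
  · subst ht; exact absSq_wedge_mem_strong μ
  · refine (mem_posCone_iff ht).mpr ⟨absSq_mem_realForms (wedge_mem_pqForms μ),
      fun q hq ψ hψ => ?_⟩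
    rw [absSq_mul_absSq (wedge_mem_pqForms μ) (testForms_subset t q hψ)]
    exact isPositiveTop_absSq hq
      (mul_mem_pqForms_zero (wedge_mem_pqForms μ) (testForms_subset t q hψ))

end Cone

/-! ### Behaviour of the cones under restriction, fibre component and recombination. -/

namespace LineSplitting

variable {V W : Type*} [AddCommGroup V] [Module ℂ V] [AddCommGroup W] [Module ℂ W]
variable (s : LineSplitting V W)

theorem ext_mem_testForms (t : PosType) {q : ℕ} {χ : Form W} (hχ : χ ∈ testForms W t q) :
    s.ext χ ∈ testForms V t q := by
  cases t with
  | hermitian => exact pullback_mem_pqForms _ hχ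
  | _ =>
    obtain ⟨c, μ, rfl⟩ := hχ
    exact ⟨c, _, by rw [map_smul, pullback_wedge]⟩

theorem form_mul_ext_mem_testForms (t : PosType) {q : ℕ} {χ : Form W}
    (hχ : χ ∈ testForms W t q) : s.form * s.ext χ ∈ testForms V t (q + 1) := by
  cases t with
  | hermitian =>
    exact mem_pqForms_of_eq (mul_mem_pqForms (oneForm_mem_pqForms _)
      (pullback_mem_pqForms _ hχ)) (add_comm _ _) rfl
  | _ =>
    obtain ⟨c, μ, rfl⟩ := hχ
    exact ⟨c, Fin.cons s.coord fun j => μ j ∘ₗ s.proj, by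
      rw [map_smul, pullback_wedge, wedge_cons, mul_smul_comm]⟩

theorem exists_eq_ext_of_mem_testForms (t : PosType) {ψ : Form V} (hψ : ψ ∈ testForms V t 0) :
    ∃ A ∈ testForms W t 0, ψ = s.ext A := by
  cases t with
  | hermitian => exact s.exists_eq_ext_of_mem_pqForms_zero hψ
  | _ =>
    obtain ⟨c, μ, rfl⟩ := hψ
    exact ⟨_, ⟨c, Fin.elim0, rfl⟩, by simp [wedge_of_zero]⟩

theorem exists_eq_of_mem_testForms (t : PosType) {q : ℕ} {ψ : Form V}
    (hψ : ψ ∈ testForms V t (q + 1)) :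
    ∃ A ∈ testForms W t (q + 1), ∃ B ∈ testForms W t q, ψ = s.ext A + s.form * s.ext B := by
  cases t with
  | hermitian => exact s.exists_holomorphic_eq hψ
  | _ =>
    obtain ⟨c, μ, rfl⟩ := hψ
    obtain ⟨β, d, χ, h⟩ := s.exists_wedge_eq μ
    refine ⟨_, ⟨c, Fin.cons β χ, rfl⟩, _, ⟨c * d, χ, rfl⟩, ?_⟩
    rw [h, wedge_cons, map_smul, map_smul, map_mul, mul_smul_comm, mul_smul, ← smul_add, add_mul,
      smul_mul_assoc]

variable [FiniteDimensional ℂ W]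

/-- The complementary degrees of `θ` on `W` and of `Ω` on `V` agree, so a test form `χ` on `W` is
extended to `V`; the fibre component of the resulting top form is `θ∧|χ|²`. In the strong case a
generator `(β + dγ)∧χ` has fibre component `|d|²|χ|²`. -/
theorem fiber_mem_posCone {t : PosType} {p : ℕ} {Ω : Form V} (hΩ : Ω ∈ posCone V t (p + 1)) :
    s.fiber Ω ∈ posCone W t p := by
  by_cases ht : t = .strong
  · subst ht
    refine strong_induction (P := fun Ω => s.fiber Ω ∈ posCone W .strong p) ?_ ?_ ?_ hΩ
    · rw [map_zero]; exact zero_mem_strong _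
    · intro Ω Ω' h h'; rw [map_add]; exact add_mem_strong h h'
    · intro r μ hr
      rw [map_smul]
      refine smul_mem_strong ?_ hr
      obtain ⟨β, d, χ, h⟩ := s.exists_wedge_eq μ
      rw [h, add_mul, smul_mul_assoc, ← mul_smul_comm, ← map_smul, ← map_mul, ← wedge_cons,
        s.ext_add_form_mul_ext_sq (wedge_mem_pqForms _)
          (Submodule.smul_mem _ _ (wedge_mem_pqForms χ)), fiber_comb, absSq_smul]
      exact smul_mem_strong (absSq_wedge_mem_strong χ) (Complex.normSq_nonneg d)
  · rw [mem_posCone_iff ht] at hΩ ⊢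
    refine ⟨s.fiber_mem_realForms hΩ.1, fun q hq χ hχ => ?_⟩
    have h1 := hΩ.2 q (by rw [s.finrank_eq]; omega) _ (s.ext_mem_testForms t hχ)
    obtain ⟨ξ, hξ, η, hη, ζ, hζ, θ, hθ, h⟩ := s.exists_eq_comb hΩ.1.1
    have hχ2 := absSq_mem_pqForms (testForms_subset t q hχ)
    rw [h, ← pullback_absSq, comb_mul_ext] at h1
    have h2 := h1.fiber s
    rw [fiber_comb] at h2
    rwa [h, fiber_comb]

variable [FiniteDimensional ℂ V]

/-- Here the complementary degree drops by one on `W`, so `χ` is tested through `γ∧χ`: the factor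
`iγ∧γ̄` kills all components of `Ω` except `ξ`. -/
theorem res_mem_posCone {t : PosType} {p : ℕ} {Ω : Form V} (hΩ : Ω ∈ posCone V t (p + 1)) :
    s.res Ω ∈ posCone W t (p + 1) := by
  by_cases ht : t = .strong
  · subst ht
    refine strong_induction (P := fun Ω => s.res Ω ∈ posCone W .strong (p + 1)) ?_ ?_ ?_ hΩ
    · rw [map_zero]; exact zero_mem_strong _
    · intro Ω Ω' h h'; rw [map_add]; exact add_mem_strong h h'
    · intro r μ hr
      rw [map_smul, pullback_absSq, pullback_wedge]
      exact smul_mem_strong (absSq_wedge_mem_strong _) hr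
  · rw [mem_posCone_iff ht] at hΩ ⊢
    refine ⟨pullback_mem_realForms _ hΩ.1, fun q hq χ hχ => ?_⟩
    have h1 := hΩ.2 (q + 1) (by rw [s.finrank_eq]; omega) _ (s.form_mul_ext_mem_testForms t hχ)
    obtain ⟨ξ, -, η, -, ζ, -, θ, -, h⟩ := s.exists_eq_comb hΩ.1.1
    have h2 := pullback_mem_pqForms s.proj (testForms_subset t q hχ)
    rw [add_comm q 1, ← absSq_mul_absSq (oneForm_mem_pqForms _) h2, h, ← mul_assoc,
      comb_mul_form₂, ← pullback_absSq, comb_mul_ext, zero_mul, comb_zero_left,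
      isPositiveTop_form₂_mul_ext] at h1
    rwa [h, res_comb]

theorem comb_mem_posCone {t : PosType} {p : ℕ} {ξ θ : Form W} (hξ : ξ ∈ posCone W t (p + 1))
    (hθ : θ ∈ posCone W t p) : s.comb ξ 0 0 θ ∈ posCone V t (p + 1) := by
  by_cases ht : t = .strong
  · subst ht
    have e : s.comb ξ 0 0 θ = s.ext ξ + s.form₂ * s.ext θ := by
      simp only [comb, map_zero, mul_zero, add_zero]
    rw [e]
    refine add_mem_strong ?_ ?_
    · refine strong_induction (P := fun ω => s.ext ω ∈ posCone V .strong (p + 1)) ?_ ?_ ?_ hξ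
      · rw [map_zero]; exact zero_mem_strong _
      · intro Ω Ω' h h'; rw [map_add]; exact add_mem_strong h h'
      · intro r μ hr
        rw [map_smul, pullback_absSq, pullback_wedge]
        exact smul_mem_strong (absSq_wedge_mem_strong _) hr
    · refine strong_induction (P := fun ω => s.form₂ * s.ext ω ∈ posCone V .strong (p + 1))
        ?_ ?_ ?_ hθ
      · rw [map_zero, mul_zero]; exact zero_mem_strong _
      · intro Ω Ω' h h'; rw [map_add, mul_add]; exact add_mem_strong h h'
      · intro r μ hr
        rw [map_smul, mul_smul_comm, pullback_absSq, pullback_wedge,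
          absSq_mul_absSq (oneForm_mem_pqForms _) (wedge_mem_pqForms _), ← wedge_cons, add_comm 1 p]
        exact smul_mem_strong (absSq_wedge_mem_strong _) hr
  · rw [mem_posCone_iff ht] at hξ hθ ⊢
    refine ⟨s.comb_mem_realForms hξ.1 hθ.1, fun q hq ψ hψ => ?_⟩
    rw [s.finrank_eq] at hq
    have hc := commute_of_mem_pqForms (pullback_mem_pqForms s.proj hξ.1.1)
    cases q with
    | zero =>
      obtain ⟨A, hA, rfl⟩ := s.exists_eq_ext_of_mem_testForms t hψ
      -- In this case `p + 1 = dim W + 1`, so `W` carries no nonzero `(p+1,p+1)`-forms.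
      have hξ0 : ξ = 0 := eq_zero_of_mem_pqForms hξ.1.1 (Or.inl (by omega))
      rw [hξ0, comb_zero_left, mul_assoc, ← pullback_absSq, ← map_mul,
        isPositiveTop_form₂_mul_ext]
      exact hθ.2 0 (by omega) A hA
    | succ q =>
      obtain ⟨A, hA, B, hB, rfl⟩ := s.exists_eq_of_mem_testForms t hψ
      have hA' := testForms_subset t _ hA
      have hB' := testForms_subset t _ hB
      -- Since `p + 1 + q = dim W`, the products of `ξ` with `|A|²`, `B∧Ā` and `A∧B̄` exceed the
      -- dimension in one of the two degrees. Only the coefficient `ξ∧|B|² + θ∧|A|²` of `iγ∧γ̄`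
      -- survives.
      rw [s.ext_add_form_mul_ext_sq hA' hB', s.comb_mul_comb hc,
        eq_zero_of_mem_pqForms (mul_mem_pqForms hξ.1.1 (absSq_mem_pqForms hA'))
          (Or.inl (by omega)),
        eq_zero_of_mem_pqForms (mul_mem_pqForms hξ.1.1 (Submodule.smul_mem _ _
          (mul_mem_pqForms hB' (conj_mem_pqForms hA')))) (Or.inr (by omega)),
        eq_zero_of_mem_pqForms (mul_mem_pqForms hξ.1.1 (Submodule.smul_mem _ _
          (Submodule.smul_mem _ _ (mul_mem_pqForms hA' (conj_mem_pqForms hB')))))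
          (Or.inl (by omega)),
        comb_zero_left, isPositiveTop_form₂_mul_ext]
      exact (hξ.2 q (by omega) B hB).add (hθ.2 (q + 1) (by omega) A hA)

end LineSplitting

end PositiveForms

/-! ### Interior of a cone as its algebraic interior. -/

namespace PositiveForms

/-- A point from which a convex set of a finite-dimensional space extends in all directions is an
interior point. -/
theorem mem_interior_of_forall_exists_sub_smul_mem {E : Type*} [AddCommGroup E] [Module ℝ E]
    [TopologicalSpace E] [IsModuleTopology ℝ E] [FiniteDimensional ℝ E] {C : Set E}
    (hC : Convex ℝ C) {x : E} (hx : ∀ y, ∃ ε : ℝ, 0 < ε ∧ x - ε • y ∈ C) : x ∈ interior C := by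
  have hxC : x ∈ C := by
    obtain ⟨ε, -, h⟩ := hx 0
    simpa using h
  let b := finBasis ℝ E
  -- Dimension `0` is separated because the averaging below divides by the dimension.
  rcases Nat.eq_zero_or_pos (finrank ℝ E) with h0 | hpos
  · have : Subsingleton E := finrank_zero_iff.mp h0
    have : C = Set.univ := Set.eq_univ_of_forall fun y => Subsingleton.elim x y ▸ hxC
    rw [this, interior_univ]
    exact Set.mem_univ x
  choose ε₁ hε₁ h₁ using fun i => hx (b i)
  choose ε₂ hε₂ h₂ using fun i => hx (-b i)
  have hseg : ∀ i, ∀ t : ℝ, |t| < min (ε₁ i) (ε₂ i) → x + t • b i ∈ C := by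
    have aux : ∀ (y : E) (ε t : ℝ), 0 < ε → x + ε • y ∈ C → 0 ≤ t → t ≤ ε → x + t • y ∈ C := by
      intro y ε t hε hy ht hte
      have h := hC.add_smul_mem hxC hy (t := t / ε) ⟨by positivity, by
        rwa [div_le_one hε]⟩
      rwa [smul_smul, div_mul_cancel₀ _ hε.ne'] at h
    intro i t ht
    rcases le_total 0 t with h | h
    · rw [abs_of_nonneg h] at ht
      refine aux (b i) (ε₂ i) t (hε₂ i) ?_ h (ht.trans_le (min_le_right _ _)).le
      simpa using h₂ i
    · rw [abs_of_nonpos h] at ht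
      have := aux (-b i) (ε₁ i) (-t) (hε₁ i) (by simpa [sub_eq_add_neg] using h₁ i)
        (by linarith) (ht.trans_le (min_le_left _ _)).le
      simpa using this
  have hd : (0 : ℝ) < finrank ℝ E := by exact_mod_cast hpos
  have hcont : ∀ i, Continuous fun y : E => |finrank ℝ E * (b.coord i y - b.coord i x)| := by
    intro i
    have := IsModuleTopology.continuous_of_linearMap (b.coord i)
    fun_prop
  refine mem_interior.mpr ⟨⋂ i, {y | |finrank ℝ E * (b.coord i y - b.coord i x)| <
    min (ε₁ i) (ε₂ i)}, fun y hy => ?_, isOpen_iInter_of_finite fun i =>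
      isOpen_lt (hcont i) continuous_const, ?_⟩
  · rw [Set.mem_iInter] at hy
    -- A point `y` near `x` is the average, over the basis, of points that differ from `x` along one
    -- basis vector only, by the dimension times the coordinate difference; each of these lies in
    -- `C`.
    have hsum : y = ∑ i, (finrank ℝ E : ℝ)⁻¹ •
        (x + (finrank ℝ E * (b.coord i y - b.coord i x)) • b i) := by
      simp only [smul_add, Finset.sum_add_distrib, smul_smul, Finset.sum_const, Finset.card_univ,
        Fintype.card_fin, inv_mul_cancel_left₀ hd.ne', sub_smul, Finset.sum_sub_distrib,
        Basis.coord_apply, b.sum_repr]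
      rw [← Nat.cast_smul_eq_nsmul ℝ, smul_smul, mul_inv_cancel₀ hd.ne', one_smul]
      abel
    rw [hsum]
    refine hC.sum_mem (fun i _ => by positivity) ?_ fun i _ => hseg i _ (hy i)
    simp [mul_inv_cancel₀ hd.ne']
  · rw [Set.mem_iInter]
    intro i
    simp [hε₁ i, hε₂ i]

section Interior

variable {V : Type*} [AddCommGroup V] [Module ℂ V] [FiniteDimensional ℂ V]

instance finiteDimensional_realForms (p : ℕ) : FiniteDimensional ℝ (realForms V p) := by
  have : FiniteDimensional ℝ V := FiniteDimensional.complexToReal V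
  have : Module.Finite ℂ (V →ₗ[ℝ] ℂ) := Module.Finite.of_restrictScalars_finite ℝ ℂ _
  have h1 : Module.Finite ℂ (degForms V (p + p)) := exteriorPower.instFinite
  have h2 : Module.Finite ℝ (degForms V (p + p)) := FiniteDimensional.complexToReal _
  have h3 : FiniteDimensional ℝ ((degForms V (p + p)).restrictScalars ℝ) := h2
  exact Submodule.finiteDimensional_of_le (S₁ := realForms V p)
    (S₂ := (degForms V (p + p)).restrictScalars ℝ) fun ω hω => pqForms_le_degForms p p hω.1

/-- A convex combination of `x` and `x - εy`; it allows several admissible `ε` to be replaced by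
their minimum. -/
theorem sub_smul_mem_posCone_of_le {t : PosType} {p : ℕ} {x y : Form V}
    (hx : x ∈ posCone V t p) {ε δ : ℝ} (hε : 0 < ε) (h : x - (ε : ℂ) • y ∈ posCone V t p)
    (hδ : 0 ≤ δ) (hle : δ ≤ ε) : x - (δ : ℂ) • y ∈ posCone V t p := by
  have h1 := add_mem_posCone (smul_mem_posCone h (r := δ / ε) (by positivity))
    (smul_mem_posCone hx (r := 1 - δ / ε) (by rw [sub_nonneg, div_le_one hε]; exact hle))
  have e : ((δ / ε : ℝ) : ℂ) • (x - (ε : ℂ) • y) + ((1 - δ / ε : ℝ) : ℂ) • x =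
      x - (δ : ℂ) • y := by
    have : ((δ / ε : ℝ) : ℂ) * (ε : ℂ) = δ := by
      rw [← Complex.ofReal_mul, div_mul_cancel₀ _ hε.ne']
    rw [smul_sub, smul_smul, this, Complex.ofReal_sub, Complex.ofReal_one]
    module
  rwa [e] at h1

/-- For a convex set in finite dimension the interior is the algebraic interior. Beyond this point
the topology is no longer needed. -/
theorem mem_intCone_iff {t : PosType} {p : ℕ} {x : Form V} : x ∈ intCone V t p ↔
    x ∈ posCone V t p ∧
      ∀ y ∈ realForms V p, ∃ ε : ℝ, 0 < ε ∧ x - (ε : ℂ) • y ∈ posCone V t p := by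
  let _ : TopologicalSpace (realForms V p) := moduleTopology ℝ (realForms V p)
  have : IsModuleTopology ℝ (realForms V p) := ⟨rfl⟩
  have : IsTopologicalAddGroup (realForms V p) := IsModuleTopology.topologicalAddGroup ℝ _
  constructor
  · rintro ⟨x, hx, rfl⟩
    refine ⟨(interior_subset hx : x ∈ Subtype.val ⁻¹' posCone V t p), fun y hy => ?_⟩
    have hc : Continuous fun ε : ℝ => x - ε • (⟨y, hy⟩ : realForms V p) :=
      continuous_const.sub (continuous_id.smul continuous_const)
    have h0 : (fun ε : ℝ => x - ε • (⟨y, hy⟩ : realForms V p)) ⁻¹'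
        interior (Subtype.val ⁻¹' posCone V t p) ∈ nhds (0 : ℝ) := by
      refine hc.continuousAt.preimage_mem_nhds (isOpen_interior.mem_nhds ?_)
      simpa using hx
    obtain ⟨r, hr, h⟩ := Metric.mem_nhds_iff.mp h0
    refine ⟨r / 2, by positivity, ?_⟩
    have h1 : r / 2 ∈ Metric.ball (0 : ℝ) r := by
      rw [Metric.mem_ball, Real.dist_eq, sub_zero, abs_of_pos (by positivity)]
      linarith
    have h2 : x - (r / 2) • (⟨y, hy⟩ : realForms V p) ∈ Subtype.val ⁻¹' posCone V t p :=
      interior_subset (h h1)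
    exact h2
  · rintro ⟨hx, h⟩
    refine ⟨⟨x, posCone_subset_realForms t p hx⟩, ?_, rfl⟩
    refine mem_interior_of_forall_exists_sub_smul_mem ?_ fun y => h y y.2
    intro a ha b hb r r' hr hr' _
    exact add_mem_posCone (smul_mem_posCone ha hr) (smul_mem_posCone hb hr')

/-- To be in the interior of one of the cones, it suffices that small multiples of the generators
of the strong cone can be subtracted. -/
theorem mem_intCone_of_generators {t : PosType} {p : ℕ} {x : Form V} (hx : x ∈ posCone V t p)
    (h : ∀ χ : Fin p → Dual ℂ V,
      ∃ ε : ℝ, 0 < ε ∧ x - (ε : ℂ) • absSq p (wedge χ) ∈ posCone V t p) :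
    x ∈ intCone V t p := by
  -- The factor `r` makes the condition on `y` stable under real scalars of either sign. On a
  -- generator, `r ≤ 0` costs nothing, since subtracting then adds an element of the cone.
  have key : ∀ y ∈ Submodule.span ℝ (Set.range fun χ : Fin p → Dual ℂ V => absSq p (wedge χ)),
      ∀ r : ℝ, ∃ ε : ℝ, 0 < ε ∧ x - (ε : ℂ) • ((r : ℂ) • y) ∈ posCone V t p := by
    intro y hy
    induction hy using Submodule.span_induction with
    | mem y hy =>
      obtain ⟨χ, rfl⟩ := hy
      intro r
      rcases le_or_gt r 0 with hr | hr
      · refine ⟨1, one_pos, ?_⟩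
        have h1 := add_mem_posCone hx
          (smul_mem_posCone (absSq_wedge_mem_posCone t χ) (neg_nonneg.mpr hr))
        rw [Complex.ofReal_neg, neg_smul, ← sub_eq_add_neg] at h1
        rwa [Complex.ofReal_one, one_smul]
      · obtain ⟨ε, hε, h1⟩ := h χ
        refine ⟨ε / r, div_pos hε hr, ?_⟩
        rwa [smul_smul, ← Complex.ofReal_mul, div_mul_cancel₀ _ hr.ne']
    | zero => exact fun r => ⟨1, one_pos, by simpa using hx⟩
    | add y z _ _ hy hz =>
      intro r
      obtain ⟨ε, hε, h1⟩ := hy r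
      obtain ⟨δ, hδ, h2⟩ := hz r
      have hm : 0 < min ε δ := lt_min hε hδ
      have h1' := sub_smul_mem_posCone_of_le hx hε h1 hm.le (min_le_left _ _)
      have h2' := sub_smul_mem_posCone_of_le hx hδ h2 hm.le (min_le_right _ _)
      refine ⟨min ε δ / 2, by positivity, ?_⟩
      have h3 := smul_mem_posCone (add_mem_posCone h1' h2') (r := 1 / 2) (by norm_num)
      convert h3 using 1
      push_cast
      module
    | smul c y _ hy =>
      intro r
      obtain ⟨ε, hε, h1⟩ := hy (r * c)
      refine ⟨ε, hε, ?_⟩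
      change x - (ε : ℂ) • ((r : ℂ) • ((c : ℂ) • y)) ∈ _
      rwa [smul_smul (r : ℂ), ← Complex.ofReal_mul]
  refine mem_intCone_iff.mpr ⟨hx, fun y hy => ?_⟩
  obtain ⟨ε, hε, h1⟩ := key y (realForms_le_span_absSq p hy) 1
  exact ⟨ε, hε, by rwa [Complex.ofReal_one, one_smul] at h1⟩

end Interior

/-! ### Interiors along a splitting. -/

namespace LineSplitting

variable {V W : Type*} [AddCommGroup V] [Module ℂ V] [AddCommGroup W] [Module ℂ W]
variable (s : LineSplitting V W) [FiniteDimensional ℂ V] [FiniteDimensional ℂ W]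

/-- Restriction maps cone to cone and has the linear right inverse `s.ext`, so every direction on
`W` can be lifted to `V`, where subtraction is possible. The fibre component is treated alike, with
`θ ↦ iγ∧γ̄∧θ` as right inverse. -/
theorem res_mem_intCone {t : PosType} {p : ℕ} {Ω : Form V} (hΩ : Ω ∈ intCone V t (p + 1)) :
    s.res Ω ∈ intCone W t (p + 1) := by
  rw [mem_intCone_iff] at hΩ ⊢
  refine ⟨s.res_mem_posCone hΩ.1, fun y hy => ?_⟩
  obtain ⟨ε, hε, h⟩ := hΩ.2 (s.ext y) (pullback_mem_realForms _ hy)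
  refine ⟨ε, hε, ?_⟩
  have h1 := s.res_mem_posCone h
  rwa [map_sub, map_smul, res_ext] at h1

theorem fiber_mem_intCone {t : PosType} {p : ℕ} {Ω : Form V} (hΩ : Ω ∈ intCone V t (p + 1)) :
    s.fiber Ω ∈ intCone W t p := by
  rw [mem_intCone_iff] at hΩ ⊢
  refine ⟨s.fiber_mem_posCone hΩ.1, fun y hy => ?_⟩
  obtain ⟨ε, hε, h⟩ := hΩ.2 (s.comb 0 0 0 y) (s.comb_mem_realForms (zero_mem _) hy)
  refine ⟨ε, hε, ?_⟩
  have h1 := s.fiber_mem_posCone h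
  rwa [map_sub, map_smul, fiber_comb] at h1

theorem comb_mem_intCone {t : PosType} {p : ℕ} {ξ θ : Form W} (hξ : ξ ∈ intCone W t (p + 1))
    (hθ : θ ∈ intCone W t p) : s.comb ξ 0 0 θ ∈ intCone V t (p + 1) := by
  rw [mem_intCone_iff] at hξ hθ
  refine mem_intCone_of_generators (s.comb_mem_posCone hξ.1 hθ.1) fun μ => ?_
  obtain ⟨β, c, χ, hμ⟩ := s.exists_wedge_eq μ
  have hA := wedge_mem_pqForms (Fin.cons β χ : Fin (p + 1) → Dual ℂ W)
  have hB : c • wedge χ ∈ pqForms W p 0 := Submodule.smul_mem _ _ (wedge_mem_pqForms χ)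
  have hB' : (-c) • wedge χ ∈ pqForms W p 0 := Submodule.smul_mem _ _ (wedge_mem_pqForms χ)
  have split : ∀ d : ℂ, (s.ext (oneForm β) + d • s.form) * s.ext (wedge χ) =
      s.ext (wedge (Fin.cons β χ : Fin (p + 1) → Dual ℂ W)) + s.form * s.ext (d • wedge χ) := by
    intro d
    rw [wedge_cons, map_mul, map_smul, mul_smul_comm, add_mul, smul_mul_assoc]
  -- the reflected form, whose mixed components have the opposite sign
  have hrefl : absSq (p + 1) ((s.ext (oneForm β) + (-c) • s.form) * s.ext (wedge χ)) ∈
      posCone V t (p + 1) := by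
    rw [pullback_oneForm, ← oneForm_smul, ← oneForm_add, pullback_wedge, ← wedge_cons]
    exact absSq_wedge_mem_posCone t _
  obtain ⟨ε₁, hε₁, h₁⟩ := hξ.2 _ (absSq_mem_realForms hA)
  obtain ⟨ε₂, hε₂, h₂⟩ := hθ.2 _ (absSq_mem_realForms hB)
  have hm : 0 < min ε₁ ε₂ := lt_min hε₁ hε₂
  have h₁' := sub_smul_mem_posCone_of_le hξ.1 hε₁ h₁ hm.le (min_le_left _ _)
  have h₂' := sub_smul_mem_posCone_of_le hθ.1 hε₂ h₂ hm.le (min_le_right _ _)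
  generalize min ε₁ ε₂ = ε at hm h₁' h₂'
  -- The two squares `|A ± γ∧B|²` add up to the form with components `2|A|²`, `0`, `0`, `2|B|²`.
  -- Hence subtracting `ε/2` times one of them equals subtracting `ε|A|²` from `ξ` and `ε|B|²` from
  -- `θ`, then adding `ε/2` times the other.
  refine ⟨ε / 2, half_pos hm, ?_⟩
  have h := add_mem_posCone (s.comb_mem_posCone h₁' h₂')
    (smul_mem_posCone hrefl (half_pos hm).le)
  rw [split, s.ext_add_form_mul_ext_sq hA hB'] at h
  rw [hμ, split, s.ext_add_form_mul_ext_sq hA hB]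
  convert h using 1
  rw [absSq_smul, absSq_smul, Complex.normSq_neg, conj_smul, conj_smul, map_neg]
  rw [sub_eq_add_neg, ← neg_smul, comb_smul, comb_smul, comb_add, comb_add]
  push_cast
  congr 1
  · module
  · simp only [smul_mul_assoc]; module
  · simp only [mul_smul_comm]; module
  · module

end LineSplitting

/-! ### The two splittings attached to `H`, `v₀` and `α`. -/

section Hyperplane

variable {V : Type*} [AddCommGroup V] [Module ℂ V] (H : Submodule ℂ V) (v₀ : V) (hH : IsCoatom H)
  (hv₀ : v₀ ∉ H)

theorem projAlong_coe (h : H) : projAlong H v₀ hH hv₀ h = h :=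
  Submodule.projectionOnto_apply_left _ h

theorem projAlong_vec : projAlong H v₀ hH hv₀ v₀ = 0 :=
  (Submodule.projectionOnto_apply_eq_zero_iff _).mpr (Submodule.mem_span_singleton_self v₀)

theorem exists_eq_projAlong_add (v : V) :
    ∃ c : ℂ, v = projAlong H v₀ hH hv₀ v + c • v₀ := by
  have h : v - projAlong H v₀ hH hv₀ v ∈ (ℂ ∙ v₀) := by
    rw [← Submodule.projectionOnto_apply_eq_zero_iff
      (Submodule.isCompl_span_singleton_of_isCoatom_of_notMem hH hv₀), map_sub]
    exact sub_eq_zero.mpr (projAlong_coe H v₀ hH hv₀ _).symm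
  obtain ⟨c, hc⟩ := Submodule.mem_span_singleton.mp h
  exact ⟨c, by rw [hc]; abel⟩

/-- The splitting of `V` along `v₀`, with `ker α` as the image of `H`. -/
noncomputable def kerSplitting (α : Dual ℂ V) (hα : α v₀ ≠ 0) : LineSplitting V H where
  incl := H.subtype - (α ∘ₗ H.subtype).smulRight ((α v₀)⁻¹ • v₀)
  proj := projAlong H v₀ hH hv₀
  coord := α
  vec := (α v₀)⁻¹ • v₀
  proj_incl w := by
    simp [projAlong_vec, projAlong_coe]
  coord_incl w := by simp [hα]
  proj_vec := by simp [projAlong_vec]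
  coord_vec := by simp [hα]
  decomp v := by
    obtain ⟨c, hc⟩ := exists_eq_projAlong_add H v₀ hH hv₀ v
    have h1 : α v = α (projAlong H v₀ hH hv₀ v) + c * α v₀ := by
      conv_lhs => rw [hc, map_add, map_smul, smul_eq_mul]
    simp only [LinearMap.sub_apply, LinearMap.smulRight_apply, LinearMap.comp_apply,
      Submodule.subtype_apply, h1, add_smul, mul_smul, smul_inv_smul₀ hα]
    conv_rhs => rw [hc]
    abel

/-- The splitting of `V` along `v₀`, with `H` itself as the image of `H`. -/
noncomputable def hyperplaneSplitting (α : Dual ℂ V) (hα : α v₀ ≠ 0) : LineSplitting V H where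
  incl := H.subtype
  proj := projAlong H v₀ hH hv₀
  coord := α - (α ∘ₗ H.subtype) ∘ₗ projAlong H v₀ hH hv₀
  vec := (α v₀)⁻¹ • v₀
  proj_incl w := projAlong_coe H v₀ hH hv₀ w
  coord_incl w := by simp [projAlong_coe]
  proj_vec := by simp [projAlong_vec]
  coord_vec := by simp [projAlong_vec, hα]
  decomp v := by
    obtain ⟨c, hc⟩ := exists_eq_projAlong_add H v₀ hH hv₀ v
    have h1 : α v = α (projAlong H v₀ hH hv₀ v) + c * α v₀ := by
      conv_lhs => rw [hc, map_add, map_smul, smul_eq_mul]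
    simp only [LinearMap.sub_apply, LinearMap.comp_apply, Submodule.subtype_apply, h1,
      add_sub_cancel_left, mul_smul, smul_inv_smul₀ hα]
    exact hc.symm

theorem isSplitting_iff {α : Dual ℂ V} (hα : α v₀ ≠ 0) {p : ℕ} {Ω Ξ η ϑ : Form V} :
    IsSplitting H v₀ hH hv₀ α (p + 1) Ω Ξ η ϑ ↔
      ∃ ξ ∈ pqForms H (p + 1) (p + 1), ∃ η' ∈ pqForms H p (p + 1), ∃ θ ∈ pqForms H p p,
        Ξ = (kerSplitting H v₀ hH hv₀ α hα).ext ξ ∧ η = (kerSplitting H v₀ hH hv₀ α hα).ext η' ∧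
        ϑ = (kerSplitting H v₀ hH hv₀ α hα).ext θ ∧
        Ω = (kerSplitting H v₀ hH hv₀ α hα).comb ξ η' (conj H η') θ := by
  have e : ∀ ξ η' θ : Form H, (kerSplitting H v₀ hH hv₀ α hα).comb ξ η' (conj H η') θ =
      rho H v₀ hH hv₀ ξ + oneForm α * rho H v₀ hH hv₀ η' +
        conj V (oneForm α) * conj V (rho H v₀ hH hv₀ η') +
        Complex.I • (oneForm α * conj V (oneForm α) * rho H v₀ hH hv₀ θ) := by
    intro ξ η' θ
    rw [LineSplitting.comb, LineSplitting.form₂_eq, smul_mul_assoc, pullback_conj]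
    rfl
  constructor
  · rintro ⟨⟨ξ, hξ, rfl⟩, ⟨η', hη', rfl⟩, ⟨θ, hθ, rfl⟩, h⟩
    exact ⟨ξ, hξ, η', hη', θ, hθ, rfl, rfl, rfl, h.trans (e ξ η' θ).symm⟩
  · rintro ⟨ξ, hξ, η', hη', θ, hθ, rfl, rfl, rfl, h⟩
    exact ⟨⟨ξ, hξ, rfl⟩, ⟨η', hη', rfl⟩, ⟨θ, hθ, rfl⟩, h.trans (e ξ η' θ)⟩

end Hyperplane

end PositiveForms

/-! ### The theorem. -/

open PositiveForms in
theorem theoremA {V : Type*} [AddCommGroup V] [Module ℂ V] [FiniteDimensional ℂ V]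
    (H : Submodule ℂ V) (hH : IsCoatom H) (v₀ : V) (hv₀ : v₀ ∉ H)
    (α : Module.Dual ℂ V) (hα : α v₀ ≠ 0)
    (p : ℕ) (hp : 1 ≤ p) (hpn : p ≤ Module.finrank ℂ V) :
    -- every real `(p,p)`-form splits in a unique way
    (∀ Ω ∈ realForms V p, ∃! T : Form V × Form V × Form V,
      IsSplitting H v₀ hH hv₀ α p Ω T.1 T.2.1 T.2.2) ∧
    -- positivity passes from `V` to `H`
    (∀ Ω ∈ realForms V p, ∀ Ξ η ϑ : Form V, IsSplitting H v₀ hH hv₀ α p Ω Ξ η ϑ →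
      (conj V Ξ = Ξ ∧ conj V ϑ = ϑ) ∧
      ∀ t : PosType,
        (Ω ∈ posCone V t p →
          restrict H Ω ∈ posCone H t p ∧ restrict H Ξ ∈ posCone H t p ∧
            restrict H ϑ ∈ posCone H t (p - 1)) ∧
        (Ω ∈ intCone V t p →
          restrict H Ω ∈ intCone H t p ∧ restrict H Ξ ∈ intCone H t p ∧
            restrict H ϑ ∈ intCone H t (p - 1))) ∧
    -- positivity passes from `H` to `V` when `η = 0`
    (∀ Ω Ξ ϑ : Form V, IsSplitting H v₀ hH hv₀ α p Ω Ξ 0 ϑ →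
      ∀ t : PosType,
        (restrict H Ξ ∈ posCone H t p → restrict H ϑ ∈ posCone H t (p - 1) →
          Ω ∈ posCone V t p) ∧
        (restrict H Ξ ∈ intCone H t p → restrict H ϑ ∈ intCone H t (p - 1) →
          Ω ∈ intCone V t p)) := by
  obtain ⟨p, rfl⟩ : ∃ k, p = k + 1 := ⟨p - 1, by omega⟩
  let s := kerSplitting H v₀ hH hv₀ α hα
  let s' := hyperplaneSplitting H v₀ hH hv₀ α hα
  -- Both splittings use the same projection, so forms extended through `s` restrict back along the
  -- inclusion of `H`, which belongs to `s'`.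
  have hres : ∀ ω : Form H, restrict H (s.ext ω) = ω := fun ω => s'.res_ext ω
  simp only [isSplitting_iff H v₀ hH hv₀ hα, Nat.add_sub_cancel]
  refine ⟨fun Ω hΩ => ?_, ?_, ?_⟩
  · obtain ⟨ξ, hξ, η, hη, ζ, hζ, θ, hθ, h⟩ := s.exists_eq_comb hΩ.1
    have hc := hΩ.2
    rw [h, s.conj_comb] at hc
    -- Conjugation exchanges the two mixed components, so comparing the `η`-components of `Ω̄ = Ω`
    -- determines `ζ`.
    have hζη : ζ = conj H η := by
      have h1 := congrArg s.fiberHol hc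
      rw [s.fiberHol_comb, s.fiberHol_comb] at h1
      rw [← h1, conj_conj]
    rw [hζη] at h
    refine ⟨(s.ext ξ, s.ext η, s.ext θ), ⟨ξ, hξ, η, hη, θ, hθ, rfl, rfl, rfl, h⟩, ?_⟩
    rintro ⟨Ξ, η₁, ϑ⟩ ⟨ξ', -, η', -, θ', -, h₁, h₂, h₃, h'⟩
    dsimp only at h₁ h₂ h₃
    have e : s.comb ξ' η' (conj H η') θ' = s.comb ξ η (conj H η) θ := h'.symm.trans h
    have e₁ := congrArg s.res e
    have e₂ := congrArg s.fiberHol e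
    have e₃ := congrArg s.fiber e
    rw [s.res_comb, s.res_comb] at e₁
    rw [s.fiberHol_comb, s.fiberHol_comb] at e₂
    rw [s.fiber_comb, s.fiber_comb] at e₃
    rw [h₁, h₂, h₃, e₁, e₂, e₃]
  · rintro Ω hΩ Ξ η ϑ ⟨ξ, hξ, η', hη', θ, hθ, rfl, rfl, rfl, h⟩
    have hξΩ : s.res Ω = ξ := by rw [h, s.res_comb]
    have hθΩ : s.fiber Ω = θ := by rw [h, s.fiber_comb]
    refine ⟨⟨?_, ?_⟩, fun t => ⟨fun hpos => ?_, fun hint => ?_⟩⟩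
    · rw [← pullback_conj, ← hξΩ, ← pullback_conj, hΩ.2]
    · rw [← pullback_conj, ← hθΩ, (s.fiber_mem_realForms hΩ).2]
    · rw [hres, hres, ← hξΩ, ← hθΩ]
      -- `Ω|_H` differs from `Ξ|_H` in general: the former is the restriction to `H`, the latter the
      -- restriction to `ker α` read on `H`.
      exact ⟨s'.res_mem_posCone hpos, s.res_mem_posCone hpos, s.fiber_mem_posCone hpos⟩
    · rw [hres, hres, ← hξΩ, ← hθΩ]
      exact ⟨s'.res_mem_intCone hint, s.res_mem_intCone hint, s.fiber_mem_intCone hint⟩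
  · rintro Ω Ξ ϑ ⟨ξ, hξ, η', hη', θ, hθ, rfl, h0, rfl, h⟩ t
    have hη0 : η' = 0 := by rw [← hres η', ← h0, map_zero]
    rw [hη0, map_zero] at h
    rw [hres, hres, h]
    exact ⟨s.comb_mem_posCone, s.comb_mem_intCone⟩
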